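/- Let $G$ be a finite connected simple graph. A cut-vertex of $G$ is a vertex whose removal makes $G$ non-connected; the blocks (biconnected components) $B_1,\dots,B_x$ of $G$ are its maximal connected subgraphs that have no cut-vertex of their own (a bridge with its end-vertices is a block). An embedding on the sphere of a connected graph is given by its rotation system, i.e. by a circular (counter-clockwise) order of the edges around each vertex, where the rotation system is planar: $\#\text{vertices}-\#\text{edges}+\#\text{faces}=2$, the faces being obtained by face tracing. An embedding restricts to a subgraph by restricting the circular orders to the edges of the subgraph. Let $\mathcal{E}_1,\dots,\mathcal{E}_x$ be embeddings on the sphere of $B_1,\dots,B_x$. Let $v_1,\dots,v_w$ be the cut-vertices of $G$. For a cut-vertex $v$ let $\delta_v$ be its degree in $G$, let $b(v)$ be the number of blocks containing $v$, call these blocks $B_{v,1},\dots,B_{v,b(v)}$, let $\delta_{v,\sigma}$ be the degree of $v$ in $B_{v,\sigma}$, let $G(v)=B_{v,1}\cup\dots\cup B_{v,b(v)}$, and put $$E_v=\prod_{\sigma=1}^{b(v)}\delta_{v,\sigma}\prod_{j=1}^{b(v)-2}(\delta_v-j).$$ An arrangement around $v$ is an embedding on the sphere of $G(v)$ whose restriction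 to each $B_{v,\sigma}$ is the given embedding of that block. 1. There is a bijection from the set of the embeddings on the sphere of $G$ whose restriction to $B_j$ is $\mathcal{E}_j$ for all $j=1,\dots,x$ to the set of the sequences of natural numbers $$\langle c_{1,1},\dots,c_{1,b(v_1)},\dots,c_{w,1},\dots,c_{w,b(v_w)},\,d_{1,1},\dots,d_{1,b(v_1)-2},\dots,d_{w,1},\dots,d_{w,b(v_w)-2}\rangle$$ with $0\le c_{\xi,\sigma}\le\delta_{v_\xi,\sigma}-1$ for $1\le\xi\le w$, $1\le\sigma\le b(v_\xi)$, and $0\le d_{\xi,\sigma}\le\delta_{v_\xi}-\sigma-1$ for $1\le\xi\le w$, $1\le\sigma\le b(v_\xi)-2$. 2. For each cut-vertex $v_\xi$, both the arrangements around $v_\xi$ and the tuples $\langle c_{\xi,1},\dots,c_{\xi,b(v_\xi)},d_{\xi,1},\dots,d_{\xi,b(v_\xi)-2}\rangle$ within these bounds are in bijection with $\{0,\dots,E_{v_\xi}-1\}$. 3. For any choice, for each $\xi$, of a bijection $\varphi_{v_\xi}$ from the arrangements around $v_\xi$ to $\{0,\dots,E_{v_\xi}-1\}$ and of a bijection $\psi_{v_\xi}$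 from the tuples of $v_\xi$ to $\{0,\dots,E_{v_\xi}-1\}$, there is a bijection $\varphi$ as in 1 that is obtained from them cut-vertex by cut-vertex: if $\mathcal{E}$ is an embedding of $G$ extending $\mathcal{E}_1,\dots,\mathcal{E}_x$, then the part $\tau_\xi$ of $\varphi(\mathcal{E})$ that belongs to $v_\xi$ satisfies $\psi_{v_\xi}(\tau_\xi)=\varphi_{v_\xi}(\mathcal{E}|_{G(v_\xi)})$. -/

import Mathlib

namespace PlanarBlocks

variable {V : Type*} {G : SimpleGraph V}

/-! ## Blocks and cut-vertices -/

/-- `v` is a cut-vertex of `S`: it is a vertex of `S` whose removal makes `S` non-connected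
(the empty graph left over from a single vertex does not count as non-connected). -/
def IsCutVertex (S : G.Subgraph) (v : V) : Prop :=
  v ∈ S.verts ∧ ¬ (S.deleteVerts {v}).Preconnected

/-- `B` is a biconnected component (block) of `G`: a maximal connected subgraph without
cut-vertices of its own. As usual, the two end-vertices of a bridge, together with the bridge,
form a block. -/
def IsBlock (B : G.Subgraph) : Prop :=
  Maximal (fun S : G.Subgraph => S.Connected ∧ ∀ v, ¬ IsCutVertex S v) B

variable (G) in
/-- The blocks of `G`. -/
abbrev Block : Type _ := {B : G.Subgraph // IsBlock B}

variable (G) in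
/-- The cut-vertices of `G`. -/
abbrev CutVertex : Type _ := {v : V // IsCutVertex (⊤ : G.Subgraph) v}

variable (G) in
/-- The blocks of `G` that contain the vertex `v`. -/
abbrev BlockAt (v : V) : Type _ := {B : Block G // v ∈ B.1.verts}

variable (G) in
/-- The union `G(v)` of the blocks of `G` that contain `v`. -/
def starAt (v : V) : G.Subgraph := sSup {B : G.Subgraph | IsBlock B ∧ v ∈ B.verts}

/-- The degree of `v` in the subgraph `S`. -/
noncomputable def deg (S : G.Subgraph) (v : V) : ℕ := (S.neighborSet v).ncard

variable (G) in
/-- The number `b(v)` of blocks of `G` that contain `v`. -/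
noncomputable def numBlocksAt (v : V) : ℕ := Nat.card (BlockAt G v)

/-! ## Embeddings on the sphere, as rotation systems of genus zero -/

/-- A rotation system of `S`: for each vertex `v` a circular (counter-clockwise) ordering of the
edges incident to `v`. Since the graph is simple, such an edge is given by its other end-vertex,
and the ordering by the permutation `rot v`, which sends each neighbour of `v` in `S` to the next
one, has all of them in a single cycle, and (so that equal orderings are equal permutations) fixes
every other element of `V`. -/
@[ext]
structure RotationSystem (S : G.Subgraph) where
  /-- the successor permutation around each vertex -/
  rot : V → Equiv.Perm V
  /-- `rot v` is a single cycle on the neighbours of `v` -/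
  isCycleOn : ∀ v, (rot v).IsCycleOn (S.neighborSet v)
  /-- `rot v` is the identity elsewhere -/
  fixed : ∀ v w, w ∉ S.neighborSet v → rot v w = w

namespace RotationSystem

variable {S T : G.Subgraph}

/-- One step of the visit of the border of a face, keeping the face to the left: after going
along an edge from `u` to `v`, continue along the edge that precedes `v u` in counter-clockwise
order around `v`. -/
def faceStep (π : RotationSystem S) : Equiv.Perm (V × V) where
  toFun d := (d.2, (π.rot d.2).symm d.1)
  invFun d := (π.rot d.1 d.2, d.1)
  left_inv d := by simp
  right_inv d := by simp

/-- The face boundaries: the orbits of `faceStep` on the directed edges of `S`. -/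
def faceBoundaries (π : RotationSystem S) : Set (Set (V × V)) :=
  {O | ∃ d : V × V, S.Adj d.1 d.2 ∧ O = {e | π.faceStep.SameCycle d e}}

/-- The number of faces of a rotation system of a connected graph; a graph without edges has one
face, although its boundary contains no edge. -/
noncomputable def numFaces (π : RotationSystem S) : ℕ := max 1 π.faceBoundaries.ncard

/-- A rotation system of a connected finite graph is planar, i.e. it is the rotation system of a
planar drawing on the sphere, when it satisfies Euler's formula (genus zero). -/
def IsPlanar (π : RotationSystem S) : Prop :=
  S.verts.ncard + π.numFaces = S.edgeSet.ncard + 2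

/-- For `T ≤ S`, the rotation system `π` of `S` restricts to the rotation system `ρ` of `T`: the
successor in `ρ` of a neighbour `u` of `v` in `T` is the first neighbour of `v` in `T` that is met
after `u` when going round `v` according to `π`. -/
def RestrictsTo (π : RotationSystem S) (ρ : RotationSystem T) : Prop :=
  ∀ v, ∀ u ∈ T.neighborSet v, ∃ k : ℕ, 0 < k ∧ ((π.rot v) ^ k) u = ρ.rot v u ∧
    ∀ j : ℕ, 0 < j → j < k → ((π.rot v) ^ j) u ∉ T.neighborSet v

end RotationSystem

/-- The embeddings on the sphere of a connected subgraph `S`. -/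
abbrev SphereEmbedding (S : G.Subgraph) : Type _ := {π : RotationSystem S // π.IsPlanar}

/-- The embeddings of `G` on the sphere whose restriction to each block `B` is `ℰ B`. -/
abbrev EmbeddingsExtending (ℰ : ∀ B : Block G, SphereEmbedding B.1) : Type _ :=
  {π : SphereEmbedding (⊤ : G.Subgraph) // ∀ B : Block G, π.1.RestrictsTo (ℰ B).1}

/-- The arrangements around `v` of the embeddings `ℰ B` of the blocks `B` incident to `v`: the
embeddings of `G(v)` on the sphere whose restriction to each such block `B` is `ℰ B`. -/
abbrev Arrangement (ℰ : ∀ B : Block G, SphereEmbedding B.1) (v : V) : Type _ :=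
  {π : SphereEmbedding (starAt G v) // ∀ B : BlockAt G v, π.1.RestrictsTo (ℰ B.1).1}

/-! ## The tuples -/

variable (G) in
/-- The possible values of the entries `c_{v,B}`, for all the blocks `B` that contain `v`, namely
`0, …, δ_{v,B} - 1`. -/
abbrev CEntries (v : V) : Type _ := ∀ B : BlockAt G v, Fin (deg B.1.1 v)

variable (G) in
/-- The possible values of the entries `d_{v,1}, …, d_{v,b(v)-2}`: the entry with index `σ = k + 1`
is one of `0, …, δ_v - σ - 1`. -/
abbrev DEntries (v : V) : Type :=
  ∀ k : Fin (numBlocksAt G v - 2), Fin (deg (⊤ : G.Subgraph) v - (k.1 + 1))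

variable (G) in
/-- The sequences that list the entries `c` of all the cut-vertices and then the entries `d` of
all the cut-vertices. -/
abbrev Sequence : Type _ := (∀ v : CutVertex G, CEntries G v.1) × (∀ v : CutVertex G, DEntries G v.1)

variable (G) in
/-- `E_v = ∏_B δ_{v,B} · ∏_{j = 1}^{b(v) - 2} (δ_v - j)`. -/
noncomputable def numArrangements (v : V) : ℕ :=
  (∏ᶠ B : BlockAt G v, deg B.1.1 v) *
    ∏ j ∈ Finset.Icc 1 (numBlocksAt G v - 2), (deg (⊤ : G.Subgraph) v - j)

end PlanarBlocks

/-! ## Reflection length of permutations -/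

namespace PlanarBlocks

section Permutations

open Equiv Equiv.Perm

variable {X : Type*} [Fintype X] [DecidableEq X]

/-! At each vertex `v` the rotations of the blocks through `v` combine into one permutation `ρ v` of
the neighbours of `v`, with one cycle per block. An embedding of the whole graph chooses instead a
single cycle `π v` on all these neighbours. Write `ℓ` for `reflLength` (number of points minus
number of orbits). Then `ℓ (π v) = δ_v - 1` and `ℓ (ρ v) = δ_v - b(v)`, so subadditivity of `ℓ`
gives `ℓ ((ρ v)⁻¹ * π v) ≥ b(v) - 1`.

The core of the proof is that a rotation system is planar and restricts to the given embeddings of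
the blocks exactly when equality holds at every vertex, i.e. when `ρ v` lies on a geodesic from `1`
to `π v`. If equality holds, `firstReturn_of_geodesic` gives the restrictions
(`restrictsTo_of_local`); the face permutation is then short enough for genus zero, because the face
permutations of the blocks act on disjoint sets of directed edges and the blocks form a tree
(`isPlanar_of_local`). Conversely, split `v` into vertices of degree one. The genus inequality for
the split map, together with the fact that `v` separates its blocks, forces the permutation that the
split faces induce on the edges at `v` to be `ρ v` and to lie below `π v` (`local_of_isPlanar`).

So the conditions at different vertices are independent. A vertex in a single block has no choice,
hence embeddings of `G` are families of local rotations at the cut-vertices. In `G(v)` only `v` lies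
in several blocks, so arrangements around `v` are the local rotations at `v`, and an embedding
restricts to the arrangement with the same rotation at `v`. Finally `card_cyclesAbove` counts the
cycles above `ρ v`: there are `∏ δ_{v,σ} · (δ_v - 1)! / (δ_v - b(v) + 1)!`, which is `E_v` and also
the number of tuples. -/

omit [DecidableEq X] [Fintype X] in
theorem sameCycleSetoid_le_iff {σ : Perm X} {s : Setoid X} :
    SameCycle.setoid σ ≤ s ↔ ∀ x, s x (σ x) := by
  constructor
  · exact fun h x => h (show SameCycle σ x (σ x) from ⟨1, by simp⟩)
  · intro h x y hxy
    have key : ∀ (k : ℕ) z, s z ((σ ^ k) z) := by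
      intro k
      induction k with
      | zero => intro z; exact s.refl _
      | succ k ih =>
        intro z
        rw [pow_succ', Perm.mul_apply]
        exact s.trans (ih z) (h _)
    obtain ⟨k, rfl⟩ := hxy
    obtain ⟨n, rfl | rfl⟩ := k.eq_nat_or_neg
    · simpa using key n x
    · have := key n ((σ ^ (-(n : ℤ))) x)
      rw [← Perm.mul_apply, ← zpow_natCast, ← zpow_add, add_neg_cancel, zpow_zero] at this
      exact s.symm' this

/-- The number of orbits of a permutation, fixed points included. -/
noncomputable def orbitCount (σ : Perm X) : ℕ := Nat.card (Quotient (SameCycle.setoid σ))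

/-- The least number of transpositions with product `σ`. -/
noncomputable def reflLength (σ : Perm X) : ℕ := Nat.card X - orbitCount σ

omit [DecidableEq X] in
theorem card_quotient_anti {r s : Setoid X} (h : r ≤ s) :
    Nat.card (Quotient s) ≤ Nat.card (Quotient r) :=
  Nat.card_le_card_of_surjective (Quotient.map' (s₁ := r) (s₂ := s) id h) <| by
    rintro ⟨x⟩
    exact ⟨Quotient.mk r x, rfl⟩

omit [DecidableEq X] in
theorem card_quotient_lt {r s : Setoid X} (h : r ≤ s) {x y : X} (hr : ¬ r x y) (hs : s x y) :
    Nat.card (Quotient s) < Nat.card (Quotient r) := by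
  refine lt_of_le_of_ne (card_quotient_anti h) fun he => hr ?_
  have hsurj : Function.Surjective (Quotient.map' (s₁ := r) (s₂ := s) id h) := by
    rintro ⟨x⟩
    exact ⟨Quotient.mk r x, rfl⟩
  have hinj := ((Nat.bijective_iff_surjective_and_card _).2 ⟨hsurj, he.symm⟩).1
  exact Quotient.exact (hinj (a₁ := Quotient.mk r x) (a₂ := Quotient.mk r y)
    (Quotient.sound hs))

-- Identifying the class of `y` with that of `x` yields a relation that contains `s` and has at most
-- one class fewer than `r`.
omit [DecidableEq X] in
theorem card_quotient_le_succ {r s : Setoid X} (x y : X)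
    (h : ∀ t : Setoid X, r ≤ t → t x y → s ≤ t) :
    Nat.card (Quotient r) ≤ Nat.card (Quotient s) + 1 := by
  classical
  let f : Quotient r → Quotient r := fun q => if q = Quotient.mk r y then Quotient.mk r x else q
  let t : Setoid X := Setoid.ker (fun z => f (Quotient.mk r z))
  have hst : s ≤ t := by
    refine h t (fun a b hab => ?_) ?_
    · have : Quotient.mk r a = Quotient.mk r b := Quotient.sound hab
      simp only [t, Setoid.ker_def, this]
    · simp only [t, Setoid.ker_def, f]
      split_ifs <;> simp_all
  have h1 := card_quotient_anti hst
  have h2 : Nat.card (Quotient r) ≤ Nat.card (Option (Quotient t)) := by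
    refine Nat.card_le_card_of_surjective
      (fun o : Option (Quotient t) => o.elim (Quotient.mk r y) (Quotient.lift
        (fun z => f (Quotient.mk r z)) (fun a b hab => hab))) ?_
    rintro ⟨z⟩
    by_cases hz : Quotient.mk r z = Quotient.mk r y
    · exact ⟨none, hz.symm⟩
    · exact ⟨some (Quotient.mk t z), if_neg hz⟩
  rw [Finite.card_option] at h2
  omega

omit [DecidableEq X] in
theorem orbitCount_le (σ : Perm X) : orbitCount σ ≤ Nat.card X :=
  Nat.card_le_card_of_surjective _ Quotient.mk_surjective

omit [DecidableEq X] in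
theorem reflLength_add_orbitCount (σ : Perm X) : reflLength σ + orbitCount σ = Nat.card X := by
  have := orbitCount_le σ
  unfold reflLength
  omega

omit [DecidableEq X] in
@[simp]
theorem reflLength_one : reflLength (1 : Perm X) = 0 := by
  have : orbitCount (1 : Perm X) = Nat.card X := by
    refine le_antisymm (orbitCount_le _) ?_
    refine Nat.card_le_card_of_injective (fun x => Quotient.mk (SameCycle.setoid 1) x) ?_
    intro x y hxy
    exact sameCycle_one.1 (Quotient.exact hxy)
  have h := reflLength_add_orbitCount (1 : Perm X)
  omega

omit [DecidableEq X] in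
theorem eq_one_of_reflLength_eq_zero {σ : Perm X} (h : reflLength σ = 0) : σ = 1 := by
  have h1 := reflLength_add_orbitCount σ
  have hsurj : Function.Surjective (Quotient.mk (SameCycle.setoid σ)) := Quotient.mk_surjective
  have hinj := ((Nat.bijective_iff_surjective_and_card _).2
    ⟨hsurj, by unfold orbitCount at h1; omega⟩).1
  ext x
  exact (hinj (a₁ := x) (a₂ := σ x) (Quotient.sound (show SameCycle σ x (σ x) from
    ⟨1, by simp⟩))).symm

omit [DecidableEq X] [Fintype X] in
@[simp]
theorem reflLength_inv (σ : Perm X) : reflLength σ⁻¹ = reflLength σ := by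
  have : SameCycle.setoid σ⁻¹ = SameCycle.setoid σ := Setoid.ext fun x y => sameCycle_inv
  simp only [reflLength, orbitCount, this]

/-! ### Multiplication by a transposition joins or splits cycles. -/

omit [Fintype X] in
theorem mul_swap_pow_apply (σ : Perm X) {x y : X} {k : ℕ}
    (h : ∀ i, 0 < i → i < k → (σ ^ i) y ≠ x ∧ (σ ^ i) y ≠ y) :
    ∀ i, 0 < i → i ≤ k → ((σ * swap x y) ^ i) x = (σ ^ i) y := by
  intro i
  induction i with
  | zero => intro h0; omega
  | succ i ih =>
    intro _ hi
    rcases Nat.eq_zero_or_pos i with rfl | hpos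
    · simp
    · obtain ⟨h1, h2⟩ := h i hpos (by omega)
      rw [pow_succ', Perm.mul_apply, ih hpos (by omega), Perm.mul_apply,
        swap_apply_of_ne_of_ne h1 h2, pow_succ', Perm.mul_apply]

/-- Starting at `x`, the product jumps into the `σ`-cycle of `y` and follows it until it comes back
to `y`. -/
theorem sameCycle_mul_swap {σ : Perm X} {x y : X} (h : ¬ SameCycle σ x y) :
    SameCycle (σ * swap x y) x y := by
  classical
  have hex : ∃ k, 0 < k ∧ (σ ^ k) y = y := ⟨orderOf σ, orderOf_pos σ, by simp [pow_orderOf_eq_one]⟩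
  obtain ⟨hk, hky⟩ := Nat.find_spec hex
  refine ⟨(Nat.find hex : ℕ), ?_⟩
  rw [zpow_natCast, mul_swap_pow_apply σ (fun i h0 hi => ⟨fun hx => h ?_, fun hy => ?_⟩) _ hk le_rfl,
    hky]
  · exact (show SameCycle σ y x from ⟨i, by simpa using hx⟩).symm
  · exact Nat.find_min hex hi ⟨h0, hy⟩

/-- With `k` the least positive exponent such that `(σ ^ k) x = y`, the orbit of `y` under the
product is `σ x, …, (σ ^ k) x = y`; it closes up without meeting `x`. -/
theorem not_sameCycle_mul_swap {σ : Perm X} {x y : X} (h : SameCycle σ x y) (hxy : x ≠ y) :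
    ¬ SameCycle (σ * swap x y) x y := by
  classical
  have hex : ∃ k, 0 < k ∧ (σ ^ k) x = y := by
    obtain ⟨k, hk, -, hk'⟩ := h.exists_pow_eq
    exact ⟨k, hk, hk'⟩
  obtain ⟨hk, hky⟩ := Nat.find_spec hex
  set k := Nat.find hex with hkdef
  have hne : ∀ i, 0 < i → i < k → (σ ^ i) x ≠ y ∧ (σ ^ i) x ≠ x := by
    intro i h0 hi
    refine ⟨fun hy => Nat.find_min hex hi ⟨h0, hy⟩, fun hx => ?_⟩
    refine Nat.find_min hex (m := k - i) (by omega) ⟨by omega, ?_⟩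
    conv_lhs => rw [← hx]
    rw [← Perm.mul_apply, ← pow_add, Nat.sub_add_cancel hi.le, hky]
  have hpow := mul_swap_pow_apply σ hne
  rw [swap_comm y x] at hpow
  set τ := σ * swap x y with hτ
  have hτk : (τ ^ k) y = y := by rw [hpow k hk le_rfl, hky]
  intro hs
  obtain ⟨n, -, -, hn⟩ := hs.symm.exists_pow_eq
  have hmod : (τ ^ (n % k)) y = x := by
    have hmul : ∀ m, (τ ^ (k * m)) y = y := by
      intro m
      induction m with
      | zero => simp
      | succ m ih => rw [Nat.mul_succ, pow_add, Perm.mul_apply, hτk, ih]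
    rw [← Nat.mod_add_div n k, pow_add, Perm.mul_apply, hmul] at hn
    exact hn
  have hlt := Nat.mod_lt n hk
  rcases Nat.eq_zero_or_pos (n % k) with h0 | h0
  · rw [h0] at hmod
    exact hxy (by simpa using hmod.symm)
  · rw [hpow _ h0 hlt.le] at hmod
    exact (hne _ h0 hlt).2 hmod

omit [Fintype X] [DecidableEq X] in
theorem sameCycle_apply (σ : Perm X) (x : X) : SameCycle σ x (σ x) := ⟨1, by simp⟩

omit [Fintype X] in
theorem setoid_mul_swap_le {σ : Perm X} {x y : X} {t : Setoid X}
    (h : SameCycle.setoid σ ≤ t) (hxy : t x y) : SameCycle.setoid (σ * swap x y) ≤ t := by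
  rw [sameCycleSetoid_le_iff] at h ⊢
  intro z
  rw [Perm.mul_apply]
  by_cases hzx : z = x
  · subst hzx
    rw [swap_apply_left]
    exact t.trans hxy (h y)
  by_cases hzy : z = y
  · subst hzy
    rw [swap_apply_right]
    exact t.trans (t.symm hxy) (h x)
  rw [swap_apply_of_ne_of_ne hzx hzy]
  exact h z

theorem setoid_le_mul_swap {σ : Perm X} {x y : X} (h : ¬ SameCycle σ x y) :
    SameCycle.setoid σ ≤ SameCycle.setoid (σ * swap x y) := by
  have := setoid_mul_swap_le (σ := σ * swap x y) (x := x) (y := y) le_rfl (sameCycle_mul_swap h)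
  rwa [mul_assoc, swap_mul_self, mul_one] at this

theorem reflLength_mul_swap_join {σ : Perm X} {x y : X} (h : ¬ SameCycle σ x y) :
    reflLength (σ * swap x y) = reflLength σ + 1 := by
  have h1 := card_quotient_lt (setoid_le_mul_swap h) h (sameCycle_mul_swap h)
  have h2 := card_quotient_le_succ (r := SameCycle.setoid σ)
    (s := SameCycle.setoid (σ * swap x y)) x y (fun t ht hxy => setoid_mul_swap_le ht hxy)
  have h3 := reflLength_add_orbitCount σ
  have h4 := reflLength_add_orbitCount (σ * swap x y)
  unfold orbitCount at h3 h4
  omega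

theorem reflLength_mul_swap_split {σ : Perm X} {x y : X} (h : SameCycle σ x y) (hxy : x ≠ y) :
    reflLength (σ * swap x y) + 1 = reflLength σ := by
  have := reflLength_mul_swap_join (not_sameCycle_mul_swap h hxy)
  rw [mul_assoc, swap_mul_self, mul_one] at this
  exact this.symm

theorem reflLength_swap_mul_delete {σ : Perm X} {x : X} (h : σ x ≠ x) :
    reflLength (swap x (σ x) * σ) + 1 = reflLength σ := by
  have h1 : SameCycle σ⁻¹ x (σ x) := (sameCycle_inv.2 (sameCycle_apply σ x))
  have h2 := reflLength_mul_swap_split h1 h.symm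
  rw [← reflLength_inv, mul_inv_rev, swap_inv, inv_inv, reflLength_inv] at h2
  exact h2

theorem reflLength_mul_swap_delete {σ : Perm X} {x : X} (h : σ x ≠ x) :
    reflLength (σ * swap x (σ⁻¹ x)) + 1 = reflLength σ := by
  refine reflLength_mul_swap_split ?_ ?_
  · exact sameCycle_inv.1 (sameCycle_apply σ⁻¹ x)
  · intro hx
    exact h (Perm.eq_inv_iff_eq.1 hx)

/-- The genus inequality for a pair of permutations. -/
theorem genus_inequality_setoid (a b : Perm X) :
    2 * Nat.card X ≤ reflLength a + reflLength b + reflLength (a * b) +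
      2 * Nat.card (Quotient (SameCycle.setoid a ⊔ SameCycle.setoid b)) := by
  induction hn : reflLength b generalizing a b with
  | zero =>
    obtain rfl := eq_one_of_reflLength_eq_zero hn
    have h1 := card_quotient_anti (X := X) (r := SameCycle.setoid a ⊔ SameCycle.setoid 1)
      (s := SameCycle.setoid a) (sup_le le_rfl (sameCycleSetoid_le_iff.2 fun x =>
        (SameCycle.setoid a).refl x))
    have h2 := reflLength_add_orbitCount a
    have h3 := card_quotient_anti (X := X) (s := SameCycle.setoid a ⊔ SameCycle.setoid 1)
      (r := SameCycle.setoid a) le_sup_left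
    have h4 : Nat.card (Quotient (SameCycle.setoid a ⊔ SameCycle.setoid 1)) = orbitCount a :=
      le_antisymm h3 h1
    rw [mul_one, h4]
    omega
  | succ n ih =>
    obtain ⟨x, hx⟩ : ∃ x, b x ≠ x := by
      by_contra! hcon
      have : b = 1 := Perm.ext hcon
      rw [this, reflLength_one] at hn
      omega
    have hdel := reflLength_swap_mul_delete hx
    set y := b x with hy
    -- Move a transposition from `b` to `a`: the product is unchanged and `b` becomes shorter.
    set a' := a * swap x y with ha'
    set b' := swap x y * b with hb'
    have hab : a' * b' = a * b := by
      rw [ha', hb', mul_assoc, ← mul_assoc (swap x y), swap_mul_self, one_mul]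
    have hIH := ih a' b' (by omega)
    rw [hab] at hIH
    have hb_le : ∀ t : Setoid X, SameCycle.setoid b' ≤ t → t x y → SameCycle.setoid b ≤ t := by
      intro t h1 h2
      rw [sameCycleSetoid_le_iff] at h1 ⊢
      intro z
      have := h1 z
      have hz : b z = swap x y (b' z) := by simp [hb']
      rw [hz]
      by_cases h3 : b' z = x
      · rw [h3, swap_apply_left]; rw [h3] at this; exact t.trans this h2
      by_cases h4 : b' z = y
      · rw [h4, swap_apply_right]; rw [h4] at this; exact t.trans this (t.symm h2)
      rw [swap_apply_of_ne_of_ne h3 h4]; exact this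
    have ha_le : ∀ t : Setoid X, SameCycle.setoid a' ≤ t → t x y → SameCycle.setoid a ≤ t := by
      intro t h1 h2
      have := setoid_mul_swap_le h1 h2
      rwa [ha', mul_assoc, swap_mul_self, mul_one] at this
    -- If the transposition splits a cycle of `a`, both lengths drop by one, which pays for at most
    -- one new common orbit (counted twice). If it joins two cycles, the length of `a` rises by one,
    -- but `x` and `y` stay in one common orbit, so no orbit is created.
    by_cases hs : SameCycle a x y
    · have h1 : reflLength a' + 1 = reflLength a := reflLength_mul_swap_split hs hx.symm
      have h2 := card_quotient_le_succ (r := SameCycle.setoid a' ⊔ SameCycle.setoid b')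
        (s := SameCycle.setoid a ⊔ SameCycle.setoid b) x y (fun t ht hxy => sup_le
          (ha_le t (le_sup_left.trans ht) hxy) (hb_le t (le_sup_right.trans ht) hxy))
      omega
    · have h1 : reflLength a' = reflLength a + 1 := reflLength_mul_swap_join hs
      have hxy : (SameCycle.setoid a' ⊔ SameCycle.setoid b') x y :=
        (le_sup_left : SameCycle.setoid a' ≤ _) (sameCycle_mul_swap hs)
      have h2 := card_quotient_anti (r := SameCycle.setoid a ⊔ SameCycle.setoid b)
        (s := SameCycle.setoid a' ⊔ SameCycle.setoid b') (sup_le (ha_le _ le_sup_left hxy)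
          (hb_le _ le_sup_right hxy))
      omega

theorem genus_inequality {Y : Type*} [Finite Y] (a b : Perm X) (f : Y → X)
    (h : ∀ x, ∃ y, ∀ t : Setoid X, SameCycle.setoid a ≤ t → SameCycle.setoid b ≤ t → t (f y) x) :
    2 * Nat.card X ≤ reflLength a + reflLength b + reflLength (a * b) + 2 * Nat.card Y := by
  have h1 := genus_inequality_setoid a b
  have h2 : Nat.card (Quotient (SameCycle.setoid a ⊔ SameCycle.setoid b)) ≤ Nat.card Y := by
    refine Nat.card_le_card_of_surjective (fun y => Quotient.mk _ (f y)) ?_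
    rintro ⟨x⟩
    obtain ⟨y, hy⟩ := h x
    exact ⟨y, Quotient.sound (hy _ le_sup_left le_sup_right)⟩
  omega

/-- Each orbit of `a * b` lies in a common orbit of `a` and `b`, so the common orbits are no more
numerous; substitute this in the genus inequality. -/
theorem reflLength_mul_le (a b : Perm X) : reflLength (a * b) ≤ reflLength a + reflLength b := by
  have h1 := genus_inequality_setoid a b
  have h2 : Nat.card (Quotient (SameCycle.setoid a ⊔ SameCycle.setoid b)) ≤ orbitCount (a * b) := by
    refine card_quotient_anti (sameCycleSetoid_le_iff.2 fun x => ?_)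
    refine Setoid.trans' _ (y := b x) ?_ ?_
    · exact (le_sup_right : SameCycle.setoid b ≤ _) (sameCycle_apply b x)
    · exact (le_sup_left : SameCycle.setoid a ≤ _) (sameCycle_apply a (b x))
  have h3 := reflLength_add_orbitCount (a * b)
  omega

omit [DecidableEq X] in
theorem le_reflLength_of_surjective {Y : Type*} [Finite Y] (σ : Perm X) (f : Y → X)
    (h : ∀ x, ∃ y, SameCycle σ (f y) x) : Nat.card X ≤ reflLength σ + Nat.card Y := by
  have h1 := reflLength_add_orbitCount σ
  have h2 : orbitCount σ ≤ Nat.card Y := by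
    refine Nat.card_le_card_of_surjective (fun y => Quotient.mk _ (f y)) ?_
    rintro ⟨x⟩
    obtain ⟨y, hy⟩ := h x
    exact ⟨y, Quotient.sound hy⟩
  omega

omit [DecidableEq X] in
theorem reflLength_add_one_le {σ : Perm X} {A : Finset X} (hA : A.Nonempty)
    (h : ∀ x ∉ A, σ x = x) : reflLength σ + 1 ≤ A.card := by
  classical
  obtain ⟨a₀, ha₀⟩ := hA
  have h1 := reflLength_add_orbitCount σ
  have h2 : Nat.card (Option {x // x ∉ A}) ≤ orbitCount σ := by
    refine Nat.card_le_card_of_injective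
      (fun o => Quotient.mk (SameCycle.setoid σ) (o.elim a₀ Subtype.val)) ?_
    have hfix : ∀ x ∉ A, ∀ y, SameCycle σ x y → x = y := by
      intro x hx y hxy
      exact hxy.eq_of_left (h x hx)
    rintro (_ | ⟨x, hx⟩) (_ | ⟨y, hy⟩) hxy
    · rfl
    · have := hfix y hy a₀ (Quotient.exact hxy.symm)
      exact absurd (this ▸ ha₀) hy
    · have := hfix x hx a₀ (Quotient.exact hxy)
      exact absurd (this ▸ ha₀) hx
    · have := hfix x hx y (Quotient.exact hxy)
      simpa using this
  rw [Finite.card_option, Nat.card_eq_fintype_card, Fintype.card_subtype_compl,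
    Fintype.card_coe, ← Nat.card_eq_fintype_card] at h2
  have h3 : A.card ≤ Nat.card X := by
    rw [Nat.card_eq_fintype_card]; exact A.card_le_univ
  omega

end Permutations

end PlanarBlocks

/-! ## First returns and disjoint joins -/

namespace PlanarBlocks

section FirstReturn

open Equiv Equiv.Perm

variable {X : Type*}

/-- `b` is the first iterate of `a` under `σ`, after `a` itself, that lies in `A`
(membership of `b` in `A` is not required). -/
def FirstReturn (σ : Perm X) (A : Set X) (a b : X) : Prop :=
  ∃ k : ℕ, 0 < k ∧ (σ ^ k) a = b ∧ ∀ j : ℕ, 0 < j → j < k → (σ ^ j) a ∉ A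

theorem FirstReturn.of_apply (σ : Perm X) (A : Set X) (a : X) : FirstReturn σ A a (σ a) :=
  ⟨1, one_pos, by simp, fun j h0 h1 => by omega⟩

theorem FirstReturn.cons {σ : Perm X} {A : Set X} {a b : X} (ha : σ a ∉ A)
    (h : FirstReturn σ A (σ a) b) : FirstReturn σ A a b := by
  obtain ⟨k, hk, rfl, hj⟩ := h
  refine ⟨k + 1, by omega, by rw [pow_succ, Perm.mul_apply], fun j h0 h1 => ?_⟩
  obtain ⟨j, rfl⟩ := Nat.exists_eq_succ_of_ne_zero h0.ne'
  rw [Nat.succ_eq_add_one, pow_succ, Perm.mul_apply]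
  rcases Nat.eq_zero_or_pos j with rfl | hpos
  · simpa using ha
  · exact hj j hpos (by omega)

theorem FirstReturn.unique {σ : Perm X} {A : Set X} {a b c : X} (hb : FirstReturn σ A a b)
    (hc : FirstReturn σ A a c) (hbA : b ∈ A) (hcA : c ∈ A) : b = c := by
  obtain ⟨k, hk, rfl, hj⟩ := hb
  obtain ⟨l, hl, rfl, hi⟩ := hc
  rcases lt_trichotomy k l with h | rfl | h
  · exact absurd hbA (hi k hk h)
  · rfl
  · exact absurd hcA (hj l hl h)

variable [DecidableEq X]

/-- Cutting `x` out of its cycle only makes trajectories skip `x`, and visits to `x ∉ A` are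
irrelevant for returns to `A`. -/
theorem FirstReturn.of_delete {σ : Perm X} {A : Set X} {x a b : X} (hx : x ∉ A)
    (ha : a ≠ x) (h : FirstReturn (σ * swap x (σ⁻¹ x)) A a b) : FirstReturn σ A a b := by
  obtain ⟨k, hk, hab, hj⟩ := h
  set σ' := σ * swap x (σ⁻¹ x) with hσ'
  have hx' : σ' x = x := by simp [hσ']
  induction k generalizing a with
  | zero => omega
  | succ k ih =>
    have hne : σ' a ≠ x := fun h => ha (σ'.injective (h.trans hx'.symm))
    have hstep : ∀ c, FirstReturn σ A (σ' a) c → σ' a ∉ A → FirstReturn σ A a c := by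
      intro c hc hA
      by_cases h1 : σ a = x
      · have h2 : σ' a = σ x := by
          rw [hσ', Perm.mul_apply, show a = σ⁻¹ x from Perm.eq_inv_iff_eq.2 h1, swap_apply_right]
        rw [h2] at hc hA
        exact .cons (h1 ▸ hx) (.cons (h1 ▸ hA) (h1 ▸ hc))
      · have h2 : σ' a = σ a := by
          rw [hσ', Perm.mul_apply, swap_apply_of_ne_of_ne ha
            (fun h => h1 (Perm.eq_inv_iff_eq.1 h))]
        rw [h2] at hc hA
        exact .cons hA hc
    rcases Nat.eq_zero_or_pos k with rfl | hpos
    · have hb : σ' a = b := by simpa using hab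
      subst hb
      by_cases h1 : σ a = x
      · have h2 : σ' a = σ x := by
          rw [hσ', Perm.mul_apply, show a = σ⁻¹ x from Perm.eq_inv_iff_eq.2 h1, swap_apply_right]
        rw [h2]
        exact .cons (h1 ▸ hx) (h1 ▸ .of_apply σ A _)
      · have h2 : σ' a = σ a := by
          rw [hσ', Perm.mul_apply, swap_apply_of_ne_of_ne ha
            (fun h => h1 (Perm.eq_inv_iff_eq.1 h))]
        rw [h2]
        exact .of_apply σ A a
    · refine hstep b (ih hne hpos ?_ ?_) ?_
      · rw [pow_succ, Perm.mul_apply] at hab; exact hab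
      · intro j h0 h1
        have := hj (j + 1) (by omega) (by omega)
        rwa [pow_succ, Perm.mul_apply] at this
      · simpa using hj 1 one_pos (by omega)

/-- A permutation `ω` induces a first return permutation on every subset `A`, and multiplying
by a permutation of `A` changes the number of cycles of both in the same way. -/
theorem exists_firstReturn [Fintype X] (ω : Perm X) (A : Set X) :
    ∃ ω' : Perm X, (∀ x ∉ A, ω' x = x) ∧ (∀ a ∈ A, FirstReturn ω A a (ω' a)) ∧
      ∀ q : Perm X, (∀ x ∉ A, q x = x) →
        reflLength (q * ω) + reflLength ω' = reflLength (q * ω') + reflLength ω := by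
  classical
  induction hn : (Finset.univ.filter fun x => x ∉ A ∧ ω x ≠ x).card using Nat.strong_induction_on
    generalizing ω with
  | _ n ih =>
    by_cases hex : ∃ x, x ∉ A ∧ ω x ≠ x
    · obtain ⟨x, hxA, hx⟩ := hex
      set ω₁ := ω * swap x (ω⁻¹ x) with hω₁
      have hlt : (Finset.univ.filter fun x => x ∉ A ∧ ω₁ x ≠ x).card < n := by
        rw [← hn]
        refine Finset.card_lt_card ⟨fun y => ?_, fun h => ?_⟩
        · simp only [Finset.mem_filter, Finset.mem_univ, true_and]
          rintro ⟨h1, h2⟩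
          refine ⟨h1, fun h3 => h2 ?_⟩
          have hyx : y ≠ x := by rintro rfl; exact hx h3
          have hyx' : y ≠ ω⁻¹ x := by
            rintro rfl
            rw [show ω (ω⁻¹ x) = x from Perm.eq_inv_iff_eq.1 rfl] at h3
            exact hyx h3.symm
          rw [hω₁, Perm.mul_apply, swap_apply_of_ne_of_ne hyx hyx', h3]
        · have := h (Finset.mem_filter.2 ⟨Finset.mem_univ x, hxA, hx⟩)
          simp [hω₁] at this
      obtain ⟨ω', h1, h2, h3⟩ := ih _ hlt ω₁ rfl
      refine ⟨ω', h1, fun a ha => (h2 a ha).of_delete hxA (fun h => hxA (h ▸ ha)), ?_⟩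
      intro q hq
      have h4 := h3 q hq
      have h5 : reflLength ω₁ + 1 = reflLength ω := reflLength_mul_swap_delete hx
      -- Since `q` fixes `x`, the point before `x` is the same for `q * ω` as for `ω`; one
      -- transposition removes `x` from both, and both lengths drop by one.
      have h6 : reflLength (q * ω₁) + 1 = reflLength (q * ω) := by
        have hqx : (q * ω)⁻¹ x = ω⁻¹ x := by
          rw [mul_inv_rev, Perm.mul_apply, Perm.inv_eq_iff_eq.2 (hq x hxA).symm]
        have hne : (q * ω) x ≠ x := by
          intro h
          have := Perm.inv_eq_iff_eq.2 h.symm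
          rw [hqx] at this
          exact hx (Perm.inv_eq_iff_eq.1 this).symm
        have := reflLength_mul_swap_delete hne
        rwa [hqx, mul_assoc] at this
      omega
    · push Not at hex
      exact ⟨ω, hex, fun a _ => .of_apply ω A a, fun q _ => rfl⟩

end FirstReturn

/-! ### Disjoint joins and geodesics. -/

section DisjointJoin

open Equiv Equiv.Perm

variable {X ι : Type*}

/-- The permutation `σ` is obtained by letting each of the permutations `τ i`, `i ∈ T`, act on a
part of its own. -/
def IsDisjointJoin (T : Finset ι) (τ : ι → Perm X) (σ : Perm X) : Prop :=
  ∀ x, (∃ i ∈ T, σ x = τ i x ∧ ∀ j ∈ T, j ≠ i → τ j x = x ∧ τ j (σ x) = σ x) ∨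
    (σ x = x ∧ ∀ j ∈ T, τ j x = x)

/-- Where `σ` acts as `τ i` the two cancel; elsewhere `τ i` fixes the image under `σ`. This is why
the definition asks for fixed points at `σ x` and not only at `x`. -/
theorem IsDisjointJoin.erase [DecidableEq ι] {T : Finset ι} {τ : ι → Perm X} {σ : Perm X}
    (h : IsDisjointJoin T τ σ) {i : ι} (hi : i ∈ T) :
    IsDisjointJoin (T.erase i) τ ((τ i)⁻¹ * σ) := by
  intro x
  rcases h x with ⟨j, hj, h1, h2⟩ | ⟨h1, h2⟩
  · by_cases hji : j = i
    · subst hji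
      right
      refine ⟨by rw [Perm.mul_apply, h1, Perm.inv_eq_iff_eq], fun k hk => ?_⟩
      exact (h2 k (Finset.mem_of_mem_erase hk) (Finset.ne_of_mem_erase hk)).1
    · left
      have h3 : ((τ i)⁻¹ * σ) x = σ x := by
        rw [Perm.mul_apply, Perm.inv_eq_iff_eq]
        exact (h2 i hi (Ne.symm hji)).2.symm
      refine ⟨j, Finset.mem_erase.2 ⟨hji, hj⟩, h3.trans h1, fun k hk hkj => ?_⟩
      rw [h3]
      exact h2 k (Finset.mem_of_mem_erase hk) hkj
  · right
    refine ⟨?_, fun k hk => h2 k (Finset.mem_of_mem_erase hk)⟩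
    rw [Perm.mul_apply, h1, Perm.inv_eq_iff_eq]
    exact (h2 i hi).symm

variable [Fintype X] [DecidableEq X]

theorem IsDisjointJoin.reflLength_le {T : Finset ι} {τ : ι → Perm X} {σ : Perm X}
    (h : IsDisjointJoin T τ σ) : reflLength σ ≤ ∑ i ∈ T, reflLength (τ i) := by
  classical
  induction hT : T.card generalizing T σ with
  | zero =>
    rw [Finset.card_eq_zero] at hT
    subst hT
    have : σ = 1 := by
      ext x
      rcases h x with ⟨i, hi, -⟩ | ⟨h1, -⟩
      · simp at hi
      · exact h1
    simp [this]
  | succ n ih =>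
    obtain ⟨i, hi⟩ : T.Nonempty := Finset.card_pos.1 (by omega)
    have h1 := ih (h.erase hi) (by rw [Finset.card_erase_of_mem hi]; omega)
    have h2 := reflLength_mul_le (τ i) ((τ i)⁻¹ * σ)
    rw [mul_inv_cancel_left] at h2
    rw [← Finset.add_sum_erase T _ hi]
    omega

/-- If `σ` is the disjoint join of cycles `τ i` on sets `A i`, and `σ` lies on a geodesic from the
identity to `π`, then `π` induces `τ i` on `A i`. -/
theorem IsDisjointJoin.firstReturn_of_geodesic {T : Finset ι} {τ : ι → Perm X} {σ π : Perm X}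
    (h : IsDisjointJoin T τ σ)
    (hgeo : ∑ i ∈ T, reflLength (τ i) + reflLength (σ⁻¹ * π) ≤ reflLength π)
    {i : ι} (hi : i ∈ T) {A : Finset X} (hA : ∀ x ∉ A, τ i x = x)
    (hcard : A.card ≤ reflLength (τ i) + 1) : ∀ a ∈ A, FirstReturn π A a (τ i a) := by
  classical
  intro a ha
  obtain ⟨π', h1, h2, h3⟩ := exists_firstReturn π (A : Set X)
  -- Left multiplication by `(τ i)⁻¹` changes the lengths of `π` and of the induced `π'` by the same
  -- amount. By the geodesic hypothesis it shortens `π` by at least `reflLength (τ i)`, while `π'`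
  -- has length at most `A.card - 1`; so nothing of `π'` is left.
  have h4 := h3 (τ i)⁻¹ (fun x hx => Perm.inv_eq_iff_eq.2 (hA x hx).symm)
  have h5 := (h.erase hi).reflLength_le
  have h6 := reflLength_mul_le ((τ i)⁻¹ * σ) (σ⁻¹ * π)
  rw [mul_assoc, mul_inv_cancel_left] at h6
  rw [← Finset.add_sum_erase T _ hi] at hgeo
  have h7 := reflLength_add_one_le (σ := π') ⟨a, ha⟩ (fun x hx => h1 x hx)
  have h8 : reflLength ((τ i)⁻¹ * π') = 0 := by omega
  have h9 : π' = τ i := by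
    have := eq_one_of_reflLength_eq_zero h8
    exact (inv_mul_eq_one.1 this).symm
  exact h9 ▸ h2 a ha

end DisjointJoin

end PlanarBlocks

/-! ## Counting the cycles above a given permutation -/

namespace PlanarBlocks

section Counting

open Equiv Equiv.Perm Finset
open scoped Nat

variable {X ι : Type*} [Fintype X] [DecidableEq X]

omit [DecidableEq X] in
theorem reflLength_add_card_le {Y : Type*} (σ : Perm X) (f : Y → X)
    (h : ∀ y y', SameCycle σ (f y) (f y') → y = y') : reflLength σ + Nat.card Y ≤ Nat.card X := by
  have h1 := reflLength_add_orbitCount σ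
  have h2 : Nat.card Y ≤ orbitCount σ :=
    Nat.card_le_card_of_injective (fun y => Quotient.mk (SameCycle.setoid σ) (f y))
      fun y y' hy => h y y' (Quotient.exact hy)
  omega

omit [DecidableEq X] in
theorem isCycleOn_iff {σ : Perm X} {A : Set X} :
    σ.IsCycleOn A ↔ (∀ a ∈ A, σ a ∈ A) ∧ ∀ a ∈ A, ∀ b ∈ A, SameCycle σ a b := by
  refine ⟨fun h => ⟨fun a ha => h.1.mapsTo ha, fun a ha b hb => h.2 ha hb⟩, fun h =>
    ⟨⟨fun a ha => h.1 a ha, σ.injective.injOn, ?_⟩, fun a ha b hb => h.2 a ha b hb⟩⟩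
  have hsub : σ '' A ⊆ A := Set.image_subset_iff.2 h.1
  exact (Set.eq_of_subset_of_ncard_le hsub
    (Set.ncard_image_of_injective A σ.injective).ge (Set.toFinite A)).ge

-- The permutation `swap y (σ y) * σ` is `σ` with `y` cut out of its cycle and made a fixed point.
omit [Fintype X] in
theorem sameCycle_delete_iff {σ : Perm X} {y : X} (hy : σ y ≠ y) {a b : X} (ha : a ≠ y)
    (hb : b ≠ y) : SameCycle (swap y (σ y) * σ) a b ↔ SameCycle σ a b := by
  set σ' := swap y (σ y) * σ with hσ'
  have h1 : ∀ c, c ≠ y → σ c ≠ y → σ' c = σ c := by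
    intro c hc hcy
    rw [hσ', Perm.mul_apply, swap_apply_of_ne_of_ne hcy (fun h => hc (σ.injective h))]
  have h2 : ∀ c, σ c = y → σ' c = σ y := by
    intro c hc
    rw [hσ', Perm.mul_apply, hc, swap_apply_left]
  have h3 : σ' y = y := by rw [hσ', Perm.mul_apply, swap_apply_right]
  constructor
  · have : SameCycle.setoid σ' ≤ SameCycle.setoid σ := by
      refine sameCycleSetoid_le_iff.2 fun x => ?_
      by_cases hx : x = y
      · subst hx
        rw [h3]
      by_cases hx' : σ x = y
      · rw [h2 x hx', ← hx']
        exact (sameCycle_apply σ x).trans (sameCycle_apply σ _)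
      · rw [h1 x hx hx']
        exact sameCycle_apply σ x
    exact fun h => this h
  · intro h
    -- Collapsing `y` onto its successor turns each step of `σ` into a step of `σ'` or into no step.
    let f : X → X := fun x => if x = y then σ y else x
    have hle : SameCycle.setoid σ ≤ (SameCycle.setoid σ').comap f := by
      refine sameCycleSetoid_le_iff.2 fun x => ?_
      change SameCycle σ' (f x) (f (σ x))
      by_cases hx : x = y
      · subst hx
        simp only [f, if_pos, if_neg hy]
        exact SameCycle.refl _ _
      by_cases hx' : σ x = y
      · simp only [f, if_neg hx, if_pos hx']
        rw [← h2 x hx']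
        exact sameCycle_apply σ' x
      · simp only [f, if_neg hx, if_neg hx']
        rw [← h1 x hx hx']
        exact sameCycle_apply σ' x
    have := hle h
    change SameCycle σ' (f a) (f b) at this
    simpa only [f, if_neg ha, if_neg hb] using this

theorem isCycleOn_delete_iff {σ : Perm X} {y : X} (hy : σ y ≠ y) {A : Set X} (hyA : y ∈ A)
    (hA : σ y ∈ A) : (swap y (σ y) * σ).IsCycleOn (A \ {y}) ↔ σ.IsCycleOn A := by
  rw [isCycleOn_iff, isCycleOn_iff]
  constructor
  · rintro ⟨h1, h2⟩
    have h4 : ∀ a ∈ A, a ≠ y → SameCycle σ a (σ y) := fun a ha hay =>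
      (sameCycle_delete_iff hy hay hy).1 (h2 a ⟨ha, hay⟩ _ ⟨hA, hy⟩)
    have h5 : ∀ a ∈ A, SameCycle σ a (σ y) := by
      intro a ha
      by_cases hay : a = y
      · exact hay ▸ sameCycle_apply σ y
      · exact h4 a ha hay
    refine ⟨fun a ha => ?_, fun a ha b hb => (h5 a ha).trans (h5 b hb).symm⟩
    by_cases hay : a = y
    · exact hay ▸ hA
    · by_cases hσ : σ a = y
      · exact hσ ▸ hyA
      · have := (h1 a ⟨ha, hay⟩).1
        rwa [Perm.mul_apply, swap_apply_of_ne_of_ne hσ (fun h => hay (σ.injective h))] at this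
  · rintro ⟨h1, h2⟩
    refine ⟨fun a ha => ?_, fun a ha b hb =>
      (sameCycle_delete_iff hy ha.2 hb.2).2 (h2 a ha.1 b hb.1)⟩
    rw [Perm.mul_apply]
    by_cases hσ : σ a = y
    · rw [hσ, swap_apply_left]
      exact ⟨hA, hy⟩
    · rw [swap_apply_of_ne_of_ne hσ (fun h => ha.2 (σ.injective h))]
      exact ⟨h1 a ha.1, hσ⟩

/-- The permutation `τ` moves only elements of `s`, and its cycles on `s` are the parts `A i`,
`i ∈ I`. -/
structure IsCyclePartition (τ : Perm X) (I : Finset ι) (A : ι → Finset X) (s : Finset X) :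
    Prop where
  nonempty : ∀ i ∈ I, (A i).Nonempty
  eq_of_mem : ∀ i ∈ I, ∀ j ∈ I, ∀ x, x ∈ A i → x ∈ A j → i = j
  mem_iff : ∀ x, x ∈ s ↔ ∃ i ∈ I, x ∈ A i
  isCycleOn : ∀ i ∈ I, τ.IsCycleOn (A i)
  fixed : ∀ x ∉ s, τ x = x

namespace IsCyclePartition

variable {τ : Perm X} {I : Finset ι} {A : ι → Finset X} {s : Finset X}

omit [Fintype X] in
theorem eq_biUnion (h : IsCyclePartition τ I A s) : s = I.biUnion A := by
  ext x
  rw [h.mem_iff, mem_biUnion]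

omit [Fintype X] [DecidableEq X] in
theorem pairwiseDisjoint (h : IsCyclePartition τ I A s) : (I : Set ι).PairwiseDisjoint A := by
  intro i hi j hj hij
  exact disjoint_left.2 fun x hx hx' => hij (h.eq_of_mem i hi j hj x hx hx')

omit [Fintype X] in
theorem card_eq (h : IsCyclePartition τ I A s) : s.card = ∑ i ∈ I, (A i).card := by
  rw [h.eq_biUnion, card_biUnion]
  exact fun i hi j hj hij => h.pairwiseDisjoint hi hj hij

omit [Fintype X] [DecidableEq X] in
theorem apply_mem (h : IsCyclePartition τ I A s) {i : ι} (hi : i ∈ I) {x : X} :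
    τ x ∈ A i ↔ x ∈ A i := by
  simpa using (h.isCycleOn i hi).apply_mem_iff (x := x)

omit [Fintype X] [DecidableEq X] in
theorem inv_apply_mem (h : IsCyclePartition τ I A s) {i : ι} (hi : i ∈ I) {x : X} :
    τ⁻¹ x ∈ A i ↔ x ∈ A i := by
  rw [← h.apply_mem hi, show τ (τ⁻¹ x) = x from Perm.eq_inv_iff_eq.1 rfl]

theorem mem_of_sameCycle (h : IsCyclePartition τ I A s) {i : ι} (hi : i ∈ I) {x y : X}
    (hxy : SameCycle τ x y) (hx : x ∈ A i) : y ∈ A i := by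
  obtain ⟨k, -, -, rfl⟩ := hxy.exists_pow_eq
  induction k with
  | zero => simpa using hx
  | succ k ih =>
    rw [pow_succ', Perm.mul_apply, h.apply_mem hi]
    exact ih ⟨k, by simp⟩

theorem reflLength_add_card (h : IsCyclePartition τ I A s) :
    reflLength τ + I.card = s.card := by
  have hrep : ∀ i : I, ∃ x, x ∈ A i := fun i => h.nonempty i i.2
  choose r hr using hrep
  have hcard : Nat.card ({x // x ∉ s} ⊕ I) = Nat.card X - s.card + I.card := by
    rw [Nat.card_sum, Nat.card_eq_fintype_card, Nat.card_eq_fintype_card,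
      Fintype.card_subtype_compl, Nat.card_eq_fintype_card]
    simp
  have hs : s.card ≤ Nat.card X := by rw [Nat.card_eq_fintype_card]; exact s.card_le_univ
  have h1 := le_reflLength_of_surjective τ (Sum.elim (fun x : {x // x ∉ s} => x.1) r) fun x => by
    by_cases hx : x ∈ s
    · obtain ⟨i, hi, hxi⟩ := (h.mem_iff x).1 hx
      exact ⟨.inr ⟨i, hi⟩, (h.isCycleOn i hi).2 (hr ⟨i, hi⟩) hxi⟩
    · exact ⟨.inl ⟨x, hx⟩, SameCycle.refl _ _⟩
  have hfix : ∀ x ∉ s, ∀ y, SameCycle τ x y → x = y :=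
    fun x hx y hxy => hxy.eq_of_left (h.fixed x hx)
  have h2 := reflLength_add_card_le τ (Sum.elim (fun x : {x // x ∉ s} => x.1) r) <| by
    rintro (⟨x, hx⟩ | i) (⟨y, hy⟩ | j) hxy
    · simpa using hfix x hx y hxy
    · have : x = r j := hfix x hx _ hxy
      exact absurd ((h.mem_iff x).2 ⟨j, j.2, this ▸ hr j⟩) hx
    · have : y = r i := hfix y hy _ hxy.symm
      exact absurd ((h.mem_iff y).2 ⟨i, i.2, this ▸ hr i⟩) hy
    · have := h.eq_of_mem i i.2 j j.2 (r j) (h.mem_of_sameCycle i.2 hxy (hr i)) (hr j)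
      exact congrArg Sum.inr (Subtype.ext this)
  omega

theorem _root_.PlanarBlocks.reflLength_add_one_of_isCycleOn {π : Perm X} {s : Finset X}
    (hs : s.Nonempty) (hπ : π.IsCycleOn s) (hfix : ∀ x ∉ s, π x = x) :
    reflLength π + 1 = s.card := by
  have h : IsCyclePartition π ({()} : Finset Unit) (fun _ => s) s :=
    ⟨fun _ _ => hs, fun _ _ _ _ _ _ _ => rfl, by simp, fun _ _ => hπ, hfix⟩
  simpa using h.reflLength_add_card

theorem delete [DecidableEq ι] (h : IsCyclePartition τ I A s) {j : ι} (hj : j ∈ I) {y : X}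
    (hy : y ∈ A j) (hyτ : τ y ≠ y) :
    IsCyclePartition (swap y (τ y) * τ) I (Function.update A j ((A j).erase y)) (s.erase y) := by
  have hmem : τ y ∈ A j := (h.apply_mem hj).2 hy
  have hsub : ∀ i x, x ∈ Function.update A j ((A j).erase y) i → x ∈ A i := by
    intro i x hx
    by_cases hij : i = j
    · subst hij
      rw [Function.update_self] at hx
      exact mem_of_mem_erase hx
    · rwa [Function.update_of_ne hij] at hx
  refine ⟨fun i hi => ?_, fun i hi k hk x hx hx' => ?_, fun x => ?_, fun i hi => ?_, fun x hx => ?_⟩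
  · by_cases hij : i = j
    · subst hij
      rw [Function.update_self]
      exact ⟨τ y, mem_erase.2 ⟨hyτ, hmem⟩⟩
    · rw [Function.update_of_ne hij]
      exact h.nonempty i hi
  · exact h.eq_of_mem i hi k hk x (hsub i x hx) (hsub k x hx')
  · rw [mem_erase, h.mem_iff]
    constructor
    · rintro ⟨hxy, i, hi, hx⟩
      refine ⟨i, hi, ?_⟩
      by_cases hij : i = j
      · subst hij
        rw [Function.update_self]
        exact mem_erase.2 ⟨hxy, hx⟩
      · rwa [Function.update_of_ne hij]
    · rintro ⟨i, hi, hx⟩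
      refine ⟨?_, i, hi, hsub i x hx⟩
      rintro rfl
      have hij : i = j := h.eq_of_mem i hi j hj _ (hsub i _ hx) hy
      subst hij
      rw [Function.update_self] at hx
      exact notMem_erase _ _ hx
  · by_cases hij : i = j
    · subst hij
      rw [Function.update_self, coe_erase]
      exact (isCycleOn_delete_iff hyτ hy hmem).2 (h.isCycleOn i hi)
    · rw [Function.update_of_ne hij]
      have hne : ∀ x ∈ A i, x ≠ y := by
        rintro x hx rfl
        exact hij (h.eq_of_mem i hi j hj _ hx hy)
      rw [isCycleOn_iff]
      refine ⟨fun a ha => ?_, fun a ha b hb =>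
        (sameCycle_delete_iff hyτ (hne a ha) (hne b hb)).2 ((h.isCycleOn i hi).2 ha hb)⟩
      have h1 : τ a ∈ A i := (h.apply_mem hi).2 ha
      rw [Perm.mul_apply, swap_apply_of_ne_of_ne (hne _ h1)
        (fun h => hne a ha (τ.injective h))]
      exact h1
  · rw [Perm.mul_apply]
    by_cases hxy : x = y
    · subst hxy
      rw [swap_apply_right]
    · have hxs : x ∉ s := fun h => hx (mem_erase.2 ⟨hxy, h⟩)
      rw [h.fixed x hxs, swap_apply_of_ne_of_ne hxy]
      rintro rfl
      exact hxs ((h.mem_iff _).2 ⟨j, hj, hmem⟩)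

theorem merge [DecidableEq ι] (h : IsCyclePartition τ I A s) {j k : ι} (hj : j ∈ I) (hk : k ∈ I)
    (hjk : j ≠ k) {y z : X} (hy : y ∈ A j) (hz : z ∈ A k) :
    IsCyclePartition (τ * swap y z) (I.erase k) (Function.update A j (A j ∪ A k)) s := by
  have hys : y ∈ s := (h.mem_iff y).2 ⟨j, hj, hy⟩
  have hzs : z ∈ s := (h.mem_iff z).2 ⟨k, hk, hz⟩
  have hns : ¬ SameCycle τ y z := fun hs =>
    hjk (h.eq_of_mem j hj k hk z (h.mem_of_sameCycle hj hs hy) hz)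
  have hle := setoid_le_mul_swap hns
  have hyz := sameCycle_mul_swap hns
  have hup : ∀ i ∈ I.erase k, ∀ x, x ∈ Function.update A j (A j ∪ A k) i ↔
      x ∈ A i ∨ (i = j ∧ x ∈ A k) := by
    intro i hi x
    by_cases hij : i = j
    · subst hij
      simp
    · simp [hij]
  refine ⟨fun i hi => ?_, fun i hi l hl x hx hx' => ?_, fun x => ?_, fun i hi => ?_, fun x hx => ?_⟩
  · obtain ⟨x, hx⟩ := h.nonempty i (mem_of_mem_erase hi)
    exact ⟨x, (hup i hi x).2 (.inl hx)⟩
  · have hiI := mem_of_mem_erase hi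
    have hlI := mem_of_mem_erase hl
    rcases (hup i hi x).1 hx with h1 | ⟨h0, h1⟩ <;>
      rcases (hup l hl x).1 hx' with h2 | ⟨h0', h2⟩
    · exact h.eq_of_mem i hiI l hlI x h1 h2
    · exact absurd (h.eq_of_mem i hiI k hk x h1 h2) (ne_of_mem_erase hi)
    · exact absurd (h.eq_of_mem l hlI k hk x h2 h1) (ne_of_mem_erase hl)
    · exact h0.trans h0'.symm
  · rw [h.mem_iff]
    constructor
    · rintro ⟨i, hi, hx⟩
      by_cases hik : i = k
      · subst hik
        have hj' := mem_erase.2 ⟨hjk, hj⟩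
        exact ⟨j, hj', (hup j hj' x).2 (.inr ⟨rfl, hx⟩)⟩
      · have hi' := mem_erase.2 ⟨hik, hi⟩
        exact ⟨i, hi', (hup i hi' x).2 (.inl hx)⟩
    · rintro ⟨i, hi, hx⟩
      rcases (hup i hi x).1 hx with hx | ⟨-, hx⟩
      · exact ⟨i, mem_of_mem_erase hi, hx⟩
      · exact ⟨k, hk, hx⟩
  · have hiI := mem_of_mem_erase hi
    by_cases hij : i = j
    · subst hij
      rw [Function.update_self, isCycleOn_iff]
      have hto : ∀ a ∈ ((A i ∪ A k : Finset X) : Set X), SameCycle (τ * swap y z) a y := by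
        intro a ha
        rcases mem_union.1 (mem_coe.1 ha) with ha | ha
        · exact hle ((h.isCycleOn i hj).2 ha hy)
        · exact (hle ((h.isCycleOn k hk).2 ha hz)).trans hyz.symm
      refine ⟨fun a ha => ?_, fun a ha b hb => (hto a ha).trans (hto b hb).symm⟩
      rw [mem_coe, mem_union] at ha ⊢
      rw [Perm.mul_apply, h.apply_mem hj, h.apply_mem hk]
      by_cases hay : a = y
      · rw [hay, swap_apply_left]; exact .inr hz
      by_cases haz : a = z
      · rw [haz, swap_apply_right]; exact .inl hy
      rwa [swap_apply_of_ne_of_ne hay haz]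
    · rw [Function.update_of_ne hij, isCycleOn_iff]
      refine ⟨fun a ha => ?_, fun a ha b hb => hle ((h.isCycleOn i hiI).2 ha hb)⟩
      rw [Perm.mul_apply, swap_apply_of_ne_of_ne]
      · exact (h.apply_mem hiI).2 ha
      · rintro rfl
        exact hij (h.eq_of_mem i hiI j hj a ha hy)
      · rintro rfl
        exact ne_of_mem_erase hi (h.eq_of_mem i hiI k hk a ha hz)
  · rw [Perm.mul_apply, swap_apply_of_ne_of_ne, h.fixed x hx]
    · rintro rfl; exact hx hys
    · rintro rfl; exact hx hzs

end IsCyclePartition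

/-! ### The recursion for cycles above a permutation, removing one point. -/

omit [Fintype X] [DecidableEq X] in
theorem prod_card_update [DecidableEq ι] {I : Finset ι} (A : ι → Finset X) {j : ι} (hj : j ∈ I)
    (B : Finset X) :
    ∏ i ∈ I, (Function.update A j B i).card = B.card * ∏ i ∈ I.erase j, (A i).card := by
  rw [← mul_prod_erase _ _ hj, Function.update_self]
  refine congrArg _ (prod_congr rfl fun i hi => ?_)
  rw [Function.update_of_ne (ne_of_mem_erase hi)]

open Classical in
/-- The cyclic orders on `s`, as permutations, that lie above `τ`, a permutation with `b` cycles
on `s`, in the absolute order. -/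
noncomputable def cyclesAbove (τ : Perm X) (b : ℕ) (s : Finset X) : Finset (Perm X) :=
  univ.filter fun π => π.IsCycleOn s ∧ (∀ x ∉ s, π x = x) ∧ reflLength (τ⁻¹ * π) + 1 = b

theorem mem_cyclesAbove {τ π : Perm X} {b : ℕ} {s : Finset X} : π ∈ cyclesAbove τ b s ↔
    π.IsCycleOn s ∧ (∀ x ∉ s, π x = x) ∧ reflLength (τ⁻¹ * π) + 1 = b := by
  simp [cyclesAbove]

/-- Left multiplication by `swap y z` cuts `y` out of a cycle in which `z` follows `y`, and it is
its own inverse; the hypothesis carries the length condition along. -/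
theorem card_cyclesAbove_apply_eq {τ τ' : Perm X} {b b' : ℕ} {s : Finset X} {y z : X}
    (hy : y ∈ s) (hz : z ∈ s) (hzy : z ≠ y)
    (h : ∀ π : Perm X, π y = z → (reflLength (τ⁻¹ * π) + 1 = b ↔
      reflLength (τ'⁻¹ * (swap y z * π)) + 1 = b')) :
    ((cyclesAbove τ b s).filter fun π => π y = z).card = (cyclesAbove τ' b' (s.erase y)).card := by
  have key : ∀ π : Perm X, π y = z → (π ∈ cyclesAbove τ b s ↔
      swap y z * π ∈ cyclesAbove τ' b' (s.erase y)) := by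
    intro π hπ
    rw [mem_cyclesAbove, mem_cyclesAbove, h π hπ, coe_erase]
    subst hπ
    rw [isCycleOn_delete_iff hzy hy hz]
    refine and_congr_right fun _ => and_congr_left fun _ => ⟨fun h1 x hx => ?_, fun h1 x hx => ?_⟩
    · by_cases hxy : x = y
      · rw [hxy, Perm.mul_apply, swap_apply_right]
      · have hxs : x ∉ s := fun h => hx (mem_erase.2 ⟨hxy, h⟩)
        rw [Perm.mul_apply, h1 x hxs, swap_apply_of_ne_of_ne hxy]
        rintro rfl
        exact hxs hz
    · have h2 := h1 x (fun h => hx (mem_of_mem_erase h))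
      rw [Perm.mul_apply, Equiv.swap_apply_eq_iff, swap_apply_of_ne_of_ne] at h2
      · exact h2
      · rintro rfl; exact hx hy
      · rintro rfl; exact hx hz
  refine card_nbij' (fun π => swap y z * π) (fun π => swap y z * π) ?_ ?_ ?_ ?_
  · intro π hπ
    obtain ⟨h1, h2⟩ := mem_filter.1 (mem_coe.1 hπ)
    exact mem_coe.2 ((key π h2).1 h1)
  · intro π hπ
    rw [mem_coe] at hπ
    have h1 : (swap y z * π) y = z := by
      have := (mem_cyclesAbove.1 hπ).2.1 y (notMem_erase y s)
      rw [Perm.mul_apply, this, swap_apply_left]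
    refine mem_coe.2 (mem_filter.2 ⟨(key _ h1).2 ?_, h1⟩)
    rwa [← mul_assoc, swap_mul_self, one_mul]
  · intro π _
    simp [← mul_assoc]
  · intro π _
    simp [← mul_assoc]

namespace IsCyclePartition

variable {τ : Perm X} {I : Finset ι} {A : ι → Finset X} {s : Finset X}

/-- Otherwise the transposition of `y` and `τ⁻¹ z` would shorten both factors of `π = τ * (τ⁻¹ *
π)`, leaving a product too short for a cycle on all of `s`. -/
theorem filter_eq_empty (h : IsCyclePartition τ I A s) {j : ι} (hj : j ∈ I) {y z : X}
    (hy : y ∈ A j) (hz : z ∈ A j) (hzτ : z ≠ τ y) :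
    ((cyclesAbove τ I.card s).filter fun π => π y = z) = ∅ := by
  refine filter_eq_empty_iff.2 fun π hπ hπy => ?_
  obtain ⟨h1, h2, h3⟩ := mem_cyclesAbove.1 hπ
  have hw : y ≠ τ⁻¹ z := fun h => hzτ (Perm.eq_inv_iff_eq.1 h).symm
  have hs : SameCycle τ y (τ⁻¹ z) := (h.isCycleOn j hj).2 hy ((h.inv_apply_mem hj).2 hz)
  have h4 := reflLength_mul_swap_split hs hw
  have h5 : (τ⁻¹ * π) y = τ⁻¹ z := by rw [Perm.mul_apply, hπy]
  have h6 := reflLength_swap_mul_delete (σ := τ⁻¹ * π) (x := y) (by rw [h5]; exact hw.symm)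
  have h7 := reflLength_mul_le (τ * swap y (τ⁻¹ z)) (swap y (τ⁻¹ z) * (τ⁻¹ * π))
  have h8 : τ * swap y (τ⁻¹ z) * (swap y (τ⁻¹ z) * (τ⁻¹ * π)) = π := by
    rw [mul_assoc, ← mul_assoc (swap y _), swap_mul_self, one_mul, mul_inv_cancel_left]
  rw [h5] at h6
  rw [h8] at h7
  have h9 := h.reflLength_add_card
  have h10 := reflLength_add_one_of_isCycleOn ⟨y, (h.mem_iff y).2 ⟨j, hj, hy⟩⟩ h1 h2
  omega

/-- Kreweras' formula, in the form of a count of the noncrossing cyclic arrangements of labelled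
cycles. -/
theorem card_cyclesAbove (h : IsCyclePartition τ I A s) {n m : ℕ} (hn : s.card = n + 1)
    (hm : I.card + m = n + 1) :
    (cyclesAbove τ I.card s).card * (m + 1)! = (∏ i ∈ I, (A i).card) * n ! := by
  classical
  induction n generalizing τ I A s m with
  | zero =>
    obtain ⟨y, hy⟩ : s.Nonempty := card_pos.1 (by omega)
    obtain ⟨j, hj, hyj⟩ := (h.mem_iff y).1 hy
    have hpos : 0 < I.card := card_pos.2 ⟨j, hj⟩
    have hI : I = {j} := by
      obtain ⟨k, hk⟩ := card_eq_one.1 (show I.card = 1 by omega)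
      rw [hk, mem_singleton] at hj
      rw [hk, hj]
    have hA : A j = s := by rw [h.eq_biUnion, hI, singleton_biUnion]
    have hset : cyclesAbove τ I.card s = {τ} := by
      ext π
      rw [mem_cyclesAbove, mem_singleton]
      constructor
      · rintro ⟨-, -, h3⟩
        have := eq_one_of_reflLength_eq_zero (σ := τ⁻¹ * π) (by omega)
        exact (inv_mul_eq_one.1 this).symm
      · rintro rfl
        refine ⟨hA ▸ h.isCycleOn j hj, h.fixed, ?_⟩
        rw [inv_mul_cancel, reflLength_one]
        omega
    have hm0 : m = 0 := by omega
    rw [hset, hI]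
    simp [hA, hn, hm0]
  | succ n ih =>
    obtain ⟨y, hy⟩ : s.Nonempty := card_pos.1 (by omega)
    obtain ⟨j, hj, hyj⟩ := (h.mem_iff y).1 hy
    -- Classify the cycles by the point that follows a fixed `y`.
    set N : X → ℕ := fun z => ((cyclesAbove τ I.card s).filter fun π => π y = z).card with hN
    have hsum : (cyclesAbove τ I.card s).card = ∑ i ∈ I, ∑ z ∈ A i, N z := by
      rw [← sum_biUnion h.pairwiseDisjoint, ← h.eq_biUnion]
      refine card_eq_sum_card_fiberwise fun π hπ => ?_
      exact (mem_cyclesAbove.1 (mem_coe.1 hπ)).1.1.mapsTo hy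
    have hself : N y = 0 := by
      rw [hN, card_eq_zero, filter_eq_empty_iff]
      intro π hπ
      refine (mem_cyclesAbove.1 hπ).1.apply_ne ?_ hy
      exact one_lt_card_iff_nontrivial.1 (by omega)
    set P := ∏ i ∈ I.erase j, (A i).card with hP
    have hj1 : 1 ≤ (A j).card := card_pos.2 ⟨y, hyj⟩
    -- Within the part of `y` only `z = τ y` contributes: removing `y` keeps the number of parts and
    -- lowers `m` by one. When `τ y = y` both sides vanish.
    have hown : (∑ z ∈ A j, N z) * (m + 1)! = (m + 1) * (((A j).card - 1) * P * n !) := by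
      have hzero : ∀ z ∈ A j, z ≠ τ y → N z = 0 := by
        intro z hz hzτ
        rw [hN, card_eq_zero]
        exact h.filter_eq_empty hj hyj hz hzτ
      rw [sum_eq_single_of_mem (τ y) ((h.apply_mem hj).2 hyj) hzero]
      by_cases hτy : τ y = y
      · have : (A j).card = 1 := by
          refine card_eq_one.2 ⟨y, eq_singleton_iff_unique_mem.2 ⟨hyj, fun x hx => ?_⟩⟩
          exact (((h.isCycleOn j hj).2 hyj hx).eq_of_left hτy).symm
        rw [hτy, hself, this]
        simp
      · have h1 : N (τ y) = (cyclesAbove (swap y (τ y) * τ) I.card (s.erase y)).card := by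
          refine card_cyclesAbove_apply_eq hy ((h.mem_iff _).2 ⟨j, hj, (h.apply_mem hj).2 hyj⟩)
            hτy fun π _ => ?_
          rw [mul_inv_rev, swap_inv, mul_assoc, ← mul_assoc (swap y _), swap_mul_self, one_mul]
        -- The number `m` is the length of `τ`, and `τ` moves `y`.
        have hmpos : m ≠ 0 := by
          rintro rfl
          have h2 := h.reflLength_add_card
          have h3 := reflLength_swap_mul_delete hτy
          omega
        obtain ⟨m, rfl⟩ := Nat.exists_eq_succ_of_ne_zero hmpos
        have h2 := ih (h.delete hj hyj hτy) (m := m) (by rw [card_erase_of_mem hy]; omega)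
          (by omega)
        rw [prod_card_update A hj, card_erase_of_mem hyj] at h2
        rw [h1, Nat.factorial_succ, mul_left_comm, Nat.succ_eq_add_one, h2]
    -- If `y` is followed by `z` in another part, the count is that for the permutation with these
    -- two parts merged so that `z` follows `y`; removing `y` then keeps `m`. All `z` in the part
    -- give the same number, which supplies the factor `(A k).card`.
    have hother : ∀ k ∈ I.erase j, (∑ z ∈ A k, N z) * (m + 1)! =
        ((A j).card - 1 + (A k).card) * (P * n !) := by
      intro k hk
      obtain ⟨hkj, hkI⟩ := mem_erase.1 hk
      have h1 : ∀ z ∈ A k, N z * (m + 1)! = ((A j).card - 1 + (A k).card) *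
          (∏ i ∈ (I.erase j).erase k, (A i).card) * n ! := by
        intro z hz
        have hw : τ⁻¹ z ∈ A k := (h.inv_apply_mem hkI).2 hz
        have hyz : z ≠ y := by
          rintro rfl
          exact hkj (h.eq_of_mem k hkI j hj _ hz hyj)
        have hyw : τ⁻¹ z ≠ y := by
          intro heq
          rw [heq] at hw
          exact hkj (h.eq_of_mem k hkI j hj _ hw hyj)
        have hmerge := h.merge hj hkI (Ne.symm hkj) hyj hw
        set τ₁ := τ * swap y (τ⁻¹ z) with hτ₁
        have hτ₁y : τ₁ y = z := by
          rw [hτ₁, Perm.mul_apply, swap_apply_left]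
          exact Perm.eq_inv_iff_eq.1 rfl
        have h2 : N z = (cyclesAbove (swap y (τ₁ y) * τ₁) (I.erase k).card (s.erase y)).card := by
          refine card_cyclesAbove_apply_eq hy ((h.mem_iff _).2 ⟨k, hkI, hz⟩) hyz fun π hπ => ?_
          have h3 : (τ⁻¹ * π) y = τ⁻¹ z := by rw [Perm.mul_apply, hπ]
          have h4 := reflLength_swap_mul_delete (σ := τ⁻¹ * π) (x := y) (by rwa [h3])
          rw [h3] at h4
          have h5 : (swap y (τ₁ y) * τ₁)⁻¹ * (swap y z * π) = swap y (τ⁻¹ z) * (τ⁻¹ * π) := by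
            rw [hτ₁y, mul_inv_rev, swap_inv, mul_assoc, ← mul_assoc (swap y _) (swap y _),
              swap_mul_self, one_mul, hτ₁, mul_inv_rev, swap_inv, mul_assoc]
          have h6 : 0 < (I.erase k).card := card_pos.2 ⟨j, mem_erase.2 ⟨Ne.symm hkj, hj⟩⟩
          rw [h5, card_erase_of_mem hkI] at *
          omega
        have hjk : j ∈ I.erase k := mem_erase.2 ⟨Ne.symm hkj, hj⟩
        have hcardI : (I.erase k).card + 1 = I.card := card_erase_add_one hkI
        have h3 := ih (hmerge.delete (y := y) hjk (by simp [hyj]) (by rwa [hτ₁y])) (m := m)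
          (by rw [card_erase_of_mem hy]; omega) (by omega)
        rw [← h2, Function.update_idem, prod_card_update A hjk, erase_right_comm, Function.update_self, card_erase_of_mem (by simp [hyj]),
          card_union_of_disjoint (h.pairwiseDisjoint hj hkI (Ne.symm hkj)),
          Nat.sub_add_comm hj1] at h3
        exact h3
      rw [sum_mul, sum_congr rfl h1, sum_const, smul_eq_mul, hP, ← mul_prod_erase _ _ hk]
      ring
    have hcard := h.card_eq
    rw [← add_sum_erase _ _ hj] at hcard
    have herase := card_erase_add_one hj
    rw [hsum, ← add_sum_erase _ _ hj, add_mul, hown, sum_mul, sum_congr rfl hother, ← sum_mul,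
      sum_add_distrib, sum_const, smul_eq_mul, ← mul_prod_erase _ _ hj, ← hP, Nat.factorial_succ]
    obtain ⟨a, ha⟩ := Nat.exists_eq_add_of_le' hj1
    set S := ∑ i ∈ I.erase j, (A i).card
    rw [ha] at hcard ⊢
    have hS : S = n + 1 - a := by omega
    -- Here `a + 1` is the size of the part of `y` and `S` the total size of the others; all
    -- contributions share the factor `P * n !`.
    have h1 : (m + 1) * a + ((I.erase j).card * a + S) = (a + 1) * (n + 1) := by
      have h2 : m + 1 + (I.erase j).card = n + 2 := by omega
      have h3 : (m + 1) * a + (I.erase j).card * a = (n + 2) * a := by rw [← add_mul, h2]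
      have h4 : S + a = n + 1 := by omega
      nlinarith
    calc _ = ((m + 1) * a + ((I.erase j).card * a + S)) * (P * n !) := by
            rw [Nat.add_sub_cancel]; ring
      _ = _ := by rw [h1]; ring

end IsCyclePartition

end Counting

end PlanarBlocks

/-! ## Blocks -/

namespace PlanarBlocks

section Blocks

variable {V : Type*} {G : SimpleGraph V}

/-- The vertices `a` and `b` are joined in the subgraph `S` by a walk that avoids `x`. -/
def JoinedAvoiding (S : G.Subgraph) (x a b : V) : Prop :=
  ∃ p : G.Walk a b, p.toSubgraph ≤ S ∧ x ∉ p.support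

namespace JoinedAvoiding

variable {S T : G.Subgraph} {x a b c : V}

theorem refl (ha : a ∈ S.verts) (hx : x ≠ a) : JoinedAvoiding S x a a :=
  ⟨.nil, by simpa using ha, by simpa using hx⟩

theorem symm (h : JoinedAvoiding S x a b) : JoinedAvoiding S x b a := by
  obtain ⟨p, h1, h2⟩ := h
  exact ⟨p.reverse, by rwa [SimpleGraph.Walk.toSubgraph_reverse],
    by simpa [SimpleGraph.Walk.support_reverse] using h2⟩

theorem trans (h : JoinedAvoiding S x a b) (h' : JoinedAvoiding S x b c) :
    JoinedAvoiding S x a c := by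
  obtain ⟨p, h1, h2⟩ := h
  obtain ⟨q, h3, h4⟩ := h'
  refine ⟨p.append q, ?_, ?_⟩
  · rw [SimpleGraph.Walk.toSubgraph_append]
    exact sup_le h1 h3
  · rw [SimpleGraph.Walk.mem_support_append_iff]
    tauto

theorem mono (h : JoinedAvoiding S x a b) (hST : S ≤ T) : JoinedAvoiding T x a b := by
  obtain ⟨p, h1, h2⟩ := h
  exact ⟨p, h1.trans hST, h2⟩

theorem of_adj (h : S.Adj a b) (ha : x ≠ a) (hb : x ≠ b) : JoinedAvoiding S x a b :=
  ⟨h.adj_sub.toWalk, by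
    rw [SimpleGraph.Adj.toSubgraph_toWalk]
    exact SimpleGraph.subgraphOfAdj_le_of_adj S h, by simp [ha, hb]⟩

theorem left_ne (h : JoinedAvoiding S x a b) : x ≠ a := by
  obtain ⟨p, -, h2⟩ := h
  rintro rfl
  exact h2 p.start_mem_support

theorem right_ne (h : JoinedAvoiding S x a b) : x ≠ b := h.symm.left_ne

end JoinedAvoiding

theorem deleteVerts_preconnected_iff (S : G.Subgraph) (x : V) :
    (S.deleteVerts {x}).Preconnected ↔
      ∀ a ∈ S.verts, ∀ b ∈ S.verts, a ≠ x → b ≠ x → JoinedAvoiding S x a b := by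
  rw [SimpleGraph.Subgraph.preconnected_iff_forall_exists_walk_subgraph]
  have key : ∀ {a b : V} (p : G.Walk a b), p.toSubgraph ≤ S.deleteVerts {x} ↔
      p.toSubgraph ≤ S ∧ x ∉ p.support := by
    intro a b p
    constructor
    · intro h
      refine ⟨h.trans SimpleGraph.Subgraph.deleteVerts_le, fun hx => ?_⟩
      have := h.1 ((p.mem_verts_toSubgraph).2 hx)
      simp at this
    · rintro ⟨h1, h2⟩
      refine ⟨fun y hy => ⟨h1.1 hy, ?_⟩, fun y z hyz => ?_⟩
      · rintro rfl
        exact h2 ((p.mem_verts_toSubgraph).1 hy)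
      · rw [SimpleGraph.Subgraph.deleteVerts_adj]
        refine ⟨h1.1 hyz.fst_mem, ?_, h1.1 hyz.snd_mem, ?_, h1.2 hyz⟩
        · rintro rfl
          exact h2 ((p.mem_verts_toSubgraph).1 hyz.fst_mem)
        · rintro rfl
          exact h2 ((p.mem_verts_toSubgraph).1 hyz.snd_mem)
  constructor
  · intro h a ha b hb hax hbx
    obtain ⟨p, hp⟩ := h (u := a) (v := b) ⟨ha, hax⟩ ⟨hb, hbx⟩
    exact ⟨p, (key p).1 hp⟩
  · rintro h a b ⟨ha, hax⟩ ⟨hb, hbx⟩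
    obtain ⟨p, hp⟩ := h a ha b hb hax hbx
    exact ⟨p, (key p).2 hp⟩

theorem IsBlock.joinedAvoiding {B : G.Subgraph} (hB : IsBlock B) {x a b : V} (ha : a ∈ B.verts)
    (hb : b ∈ B.verts) (hax : a ≠ x) (hbx : b ≠ x) : JoinedAvoiding B x a b := by
  by_cases hx : x ∈ B.verts
  · have := hB.prop.2 x
    rw [IsCutVertex, not_and, not_not, deleteVerts_preconnected_iff] at this
    exact this hx a ha b hb hax hbx
  · obtain ⟨p, hp⟩ :=
      (B.preconnected_iff_forall_exists_walk_subgraph.1 hB.prop.1.preconnected) ha hb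
    exact ⟨p, hp, fun h => hx (hp.1 ((p.mem_verts_toSubgraph).2 h))⟩

theorem not_isCutVertex_of_joinedAvoiding {S : G.Subgraph}
    (h : ∀ x, ∃ c, ∀ a ∈ S.verts, a ≠ x → JoinedAvoiding S x a c) (x : V) : ¬ IsCutVertex S x := by
  rw [IsCutVertex, not_and, not_not, deleteVerts_preconnected_iff]
  intro _ a ha b hb hax hbx
  obtain ⟨c, hc⟩ := h x
  exact (hc a ha hax).trans (hc b hb hbx).symm

/-- Distinct blocks that share the vertex `v` are separated by `v`. -/
theorem IsBlock.eq_of_joinedAvoiding {B B' : G.Subgraph} (hB : IsBlock B) (hB' : IsBlock B')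
    {v u u' : V} (hv : v ∈ B.verts) (hv' : v ∈ B'.verts) (hu : u ∈ B.verts) (hu' : u' ∈ B'.verts)
    (h : JoinedAvoiding (⊤ : G.Subgraph) v u u') : B = B' := by
  classical
  have huv := h.left_ne
  have huv' := h.right_ne
  obtain ⟨p₀, -, hp₀⟩ := h
  set p := p₀.bypass with hpdef
  have hp : p.IsPath := p₀.bypass_isPath
  have hvp : v ∉ p.support := fun h => hp₀ (p₀.support_bypass_subset_support h)
  -- If `H` has no cut-vertex, maximality makes both blocks equal to it.
  set H : G.Subgraph := B ⊔ B' ⊔ p.toSubgraph with hH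
  have hBH : B ≤ H := le_sup_left.trans le_sup_left
  have hB'H : B' ≤ H := le_sup_right.trans le_sup_left
  have hpH : p.toSubgraph ≤ H := le_sup_right
  have hconn : H.Connected := by
    refine SimpleGraph.Subgraph.connected_sup (SimpleGraph.Subgraph.connected_sup
      hB.prop.1.preconnected hB'.prop.1.preconnected ⟨v, hv, hv'⟩).preconnected
      p.toSubgraph_connected.preconnected ⟨u, .inl hu, p.start_mem_verts_toSubgraph⟩
  have hcut : ∀ x, ¬ IsCutVertex H x := by
    refine not_isCutVertex_of_joinedAvoiding fun x => ?_
    have hfst : ∀ a (ha : a ∈ p.support), x ∉ (p.takeUntil a ha).support →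
        JoinedAvoiding H x u a := fun a ha hx => by
      refine ⟨p.takeUntil a ha, le_trans ?_ hpH, hx⟩
      conv_rhs => rw [← p.take_spec ha, SimpleGraph.Walk.toSubgraph_append]
      exact le_sup_left
    have hsnd : ∀ a (ha : a ∈ p.support), x ∉ (p.dropUntil a ha).support →
        JoinedAvoiding H x a u' := fun a ha hx => by
      refine ⟨p.dropUntil a ha, le_trans ?_ hpH, hx⟩
      conv_rhs => rw [← p.take_spec ha, SimpleGraph.Walk.toSubgraph_append]
      exact le_sup_right
    by_cases hxv : x = v
    · subst hxv
      have hpu : ∀ a ∈ p.support, JoinedAvoiding H x u a := fun a ha => hfst a ha fun h =>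
        hvp (p.support_takeUntil_subset_support ha h)
      refine ⟨u, fun a ha hax => ?_⟩
      rcases ha with (ha | ha) | ha
      · exact (hB.joinedAvoiding ha hu hax huv.symm).mono hBH
      · exact ((hB'.joinedAvoiding ha hu' hax huv'.symm).mono hB'H).trans
          (hpu u' p.end_mem_support).symm
      · exact (hpu a ((p.mem_verts_toSubgraph).1 ha)).symm
    · refine ⟨v, fun a ha hax => ?_⟩
      rcases ha with (ha | ha) | ha
      · exact (hB.joinedAvoiding ha hv hax (Ne.symm hxv)).mono hBH
      · exact (hB'.joinedAvoiding ha hv' hax (Ne.symm hxv)).mono hB'H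
      · replace ha := (p.mem_verts_toSubgraph).1 ha
        -- On a path, `x ≠ a` lies on at most one side of `a`; leave `a` by the other side and go to
        -- `v` inside the block at that end.
        by_cases hx : x ∈ (p.takeUntil a ha).support
        · have hx' : x ∉ (p.dropUntil a ha).support := by
            intro hx'
            rw [← p.take_spec ha] at hp
            exact hp.ne_of_mem_support_of_append (Ne.symm hax) hx hx' rfl
          have h1 := hsnd a ha hx'
          exact h1.trans ((hB'.joinedAvoiding hu' hv' h1.right_ne.symm (Ne.symm hxv)).mono hB'H)
        · have h1 := hfst a ha hx
          exact h1.symm.trans ((hB.joinedAvoiding hu hv h1.left_ne.symm (Ne.symm hxv)).mono hBH)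
  have h1 : H = B := le_antisymm (hB.le_of_ge ⟨hconn, hcut⟩ hBH) hBH
  have h2 : H = B' := le_antisymm (hB'.le_of_ge ⟨hconn, hcut⟩ hB'H) hB'H
  exact h1.symm.trans h2

theorem IsBlock.eq_of_mem {B B' : G.Subgraph} (hB : IsBlock B) (hB' : IsBlock B') {u v : V}
    (huv : u ≠ v) (hu : u ∈ B.verts) (hv : v ∈ B.verts) (hu' : u ∈ B'.verts)
    (hv' : v ∈ B'.verts) : B = B' :=
  hB.eq_of_joinedAvoiding hB' hv hv' hu hu' (.refl (by simp) huv.symm)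

theorem IsBlock.eq_of_adj {B B' : G.Subgraph} (hB : IsBlock B) (hB' : IsBlock B') {u v : V}
    (h : B.Adj u v) (h' : B'.Adj u v) : B = B' :=
  hB.eq_of_mem hB' h.ne h.fst_mem h.snd_mem h'.fst_mem h'.snd_mem

theorem subgraphOfAdj_not_isCutVertex {u v : V} (h : G.Adj u v) (x : V) :
    ¬ IsCutVertex (G.subgraphOfAdj h) x := by
  refine not_isCutVertex_of_joinedAvoiding (fun x => ?_) x
  have huv : (G.subgraphOfAdj h).Adj u v := by simp
  have hu : u ∈ (G.subgraphOfAdj h).verts := by simp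
  have hv : v ∈ (G.subgraphOfAdj h).verts := by simp
  by_cases hxu : x = u
  · refine ⟨v, fun a ha hax => ?_⟩
    rcases ha with rfl | rfl
    · exact absurd hxu.symm hax
    · exact .refl hv (Ne.symm hax)
  · refine ⟨u, fun a ha hax => ?_⟩
    rcases ha with rfl | rfl
    · exact .refl hu hxu
    · exact .of_adj huv.symm (Ne.symm hax) hxu

theorem exists_isBlock_adj [Finite V] {u v : V} (h : G.Adj u v) :
    ∃ B : G.Subgraph, IsBlock B ∧ B.Adj u v := by
  obtain ⟨B, hle, hB⟩ := Finite.exists_le_maximal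
    (p := fun S : G.Subgraph => S.Connected ∧ ∀ v, ¬ IsCutVertex S v)
    ⟨SimpleGraph.Subgraph.subgraphOfAdj_connected h, subgraphOfAdj_not_isCutVertex h⟩
  exact ⟨B, hB, hle.2 (by simp)⟩

/-- A block consisting of `v` alone would be properly contained in the edge `v u`, against
maximality. -/
theorem IsBlock.exists_adj {B : G.Subgraph} (hB : IsBlock B) {v u : V} (hv : v ∈ B.verts)
    (hvu : G.Adj v u) : ∃ w, B.Adj v w := by
  by_cases hsub : ∃ w ∈ B.verts, w ≠ v
  · obtain ⟨w, hw, hwv⟩ := hsub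
    have : Nontrivial B.verts := ⟨⟨w, hw⟩, ⟨v, hv⟩, by simpa using hwv⟩
    exact hB.prop.1.preconnected.exists_adj_of_nontrivial ⟨v, hv⟩
  · push Not at hsub
    have hle : B ≤ G.subgraphOfAdj hvu := by
      refine ⟨fun w hw => by simp [hsub w hw], fun a b hab => ?_⟩
      exact absurd ((hsub a hab.fst_mem).trans (hsub b hab.snd_mem).symm) hab.ne
    have := hB.le_of_ge ⟨SimpleGraph.Subgraph.subgraphOfAdj_connected hvu,
      subgraphOfAdj_not_isCutVertex hvu⟩ hle
    exact ⟨u, this.2 (by simp)⟩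

/-- Take for `b` the vertex just before the first visit of the walk to `v`. -/
theorem exists_adj_joinedAvoiding {S : G.Subgraph} {a v : V} (p : G.Walk a v)
    (hp : p.toSubgraph ≤ S) (hav : a ≠ v) : ∃ b, S.Adj b v ∧ JoinedAvoiding S v a b := by
  induction p with
  | nil => exact absurd rfl hav
  | @cons a c v hac p ih =>
    have hadj : S.Adj a c := hp.2 (.inl (by simp))
    by_cases hcv : c = v
    · subst hcv
      exact ⟨a, hadj, .refl hadj.fst_mem hav.symm⟩
    · obtain ⟨b, hb, h⟩ := ih (le_trans le_sup_right hp) hcv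
      exact ⟨b, hb, .trans (.of_adj hadj hav.symm (Ne.symm hcv)) h⟩

theorem eq_of_not_isCutVertex {v u : V} (hv : ¬ IsCutVertex (⊤ : G.Subgraph) v)
    (hvu : G.Adj v u) {B B' : G.Subgraph} (hB : IsBlock B) (hB' : IsBlock B')
    (hvB : v ∈ B.verts) (hvB' : v ∈ B'.verts) : B = B' := by
  obtain ⟨w, hw⟩ := hB.exists_adj hvB hvu
  obtain ⟨w', hw'⟩ := hB'.exists_adj hvB' hvu
  rw [IsCutVertex, not_and, not_not, deleteVerts_preconnected_iff] at hv
  exact hB.eq_of_joinedAvoiding hB' hvB hvB' hw.snd_mem hw'.snd_mem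
    (hv (by simp) w (by simp) w' (by simp) hw.ne.symm hw'.ne.symm)

/-- Two vertices separated by `v` reach `v` through edges in different blocks, since within one
block the other ends of these edges would be joined avoiding `v`. -/
theorem two_le_numBlocksAt [Finite V] (hG : G.Connected) {v : V}
    (hv : IsCutVertex (⊤ : G.Subgraph) v) : 2 ≤ numBlocksAt G v := by
  obtain ⟨-, hv⟩ := hv
  rw [deleteVerts_preconnected_iff] at hv
  push Not at hv
  obtain ⟨a, -, b, -, hav, hbv, hab⟩ := hv
  obtain ⟨p⟩ := hG.preconnected a v
  obtain ⟨q⟩ := hG.preconnected b v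
  obtain ⟨a', ha', haa'⟩ := exists_adj_joinedAvoiding p le_top hav
  obtain ⟨b', hb', hbb'⟩ := exists_adj_joinedAvoiding q le_top hbv
  obtain ⟨B, hB, hBa⟩ := exists_isBlock_adj ha'.adj_sub
  obtain ⟨B', hB', hBb⟩ := exists_isBlock_adj hb'.adj_sub
  refine Finite.one_lt_card_iff_nontrivial.2
    ⟨⟨⟨⟨B, hB⟩, hBa.snd_mem⟩, ⟨⟨B', hB'⟩, hBb.snd_mem⟩, fun heq => hab ?_⟩⟩
  have heq' : B = B' := congrArg (fun x => x.1.1) heq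
  subst heq'
  exact haa'.trans (((hB.joinedAvoiding hBa.fst_mem hBb.fst_mem hBa.ne hBb.ne).mono le_top).trans
    hbb'.symm)

/-- The blocks form a tree-like structure: their numbers of vertices, decreased by one, add up to
at most the number of vertices other than a given one. -/
theorem sum_ncard_verts_add_one_le [Finite V] (hG : G.Connected) (F : Finset (Block G))
    (S : G.Subgraph) (hF : ∀ B ∈ F, B.1 ≤ S) {r : V} (hr : r ∈ S.verts) :
    ∑ B ∈ F, B.1.verts.ncard + 1 ≤ S.verts.ncard + F.card := by
  classical
  have := Fintype.ofFinite V
  -- Regard `r` as the root. A vertex `u` of `B` is sent to itself when `B` reaches `r` without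
  -- passing through `u`, and to `B` when `u` is the gate of `B` towards `r`. Only one block at `u`
  -- can lead towards `r` avoiding `u`, and each block has at most one gate, so `f` is injective.
  let f : (Σ B : F, B.1.1.verts) → {u // u ∈ S.verts ∧ u ≠ r} ⊕ F := fun q =>
    if h : ∃ w ∈ q.1.1.1.verts, JoinedAvoiding (⊤ : G.Subgraph) q.2.1 w r then
      .inl ⟨q.2.1, (hF _ q.1.2).1 q.2.2, by
        obtain ⟨w, -, hw⟩ := h
        exact hw.right_ne⟩
    else .inr q.1
  have hf : Function.Injective f := by
    rintro ⟨⟨B, hBF⟩, u, hu⟩ ⟨⟨B', hBF'⟩, u', hu'⟩ heq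
    simp only [f] at heq
    split_ifs at heq with h1 h2 h2
    · obtain ⟨w, hw, hwr⟩ := h1
      obtain ⟨w', hw', hwr'⟩ := h2
      have huu : u = u' := congrArg Subtype.val (Sum.inl.inj heq)
      subst huu
      have := B.2.eq_of_joinedAvoiding B'.2 hu hu' hw hw' (hwr.trans hwr'.symm)
      obtain rfl : B = B' := Subtype.ext this
      rfl
    · have hBB : B = B' := congrArg Subtype.val (Sum.inr.inj heq)
      subst hBB
      by_cases huu : u = u'
      · subst huu
        rfl
      · exfalso
        obtain ⟨p₀⟩ := hG.preconnected u r
        set p := p₀.bypass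
        have hp : p.IsPath := p₀.bypass_isPath
        by_cases hup : u' ∈ p.support
        · refine h1 ⟨u', hu', p.dropUntil u' hup, le_top, fun hx => ?_⟩
          rw [← p.take_spec hup] at hp
          exact hp.ne_of_mem_support_of_append huu (SimpleGraph.Walk.start_mem_support _) hx rfl
        · exact h2 ⟨u, hu, p, le_top, hup⟩
  have hcard := Nat.card_le_card_of_injective f hf
  rw [Nat.card_sigma, Nat.card_sum] at hcard
  have h1 : Nat.card {u // u ∈ S.verts ∧ u ≠ r} + 1 = S.verts.ncard := by
    rw [← Set.ncard_sdiff_singleton_add_one hr]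
    rfl
  have h2 : ∑ B : F, Nat.card B.1.1.verts = ∑ B ∈ F, B.1.verts.ncard := by
    rw [← Finset.sum_coe_sort F]
    rfl
  rw [h2, Nat.card_eq_fintype_card (α := F), Fintype.card_coe] at hcard
  omega

end Blocks

end PlanarBlocks

/-! ## The face permutation of a rotation system -/

namespace PlanarBlocks

/-! ### Permutations of pairs that act vertex by vertex. -/

section VertexPerm

open Equiv Equiv.Perm

theorem reflLength_map {X Y : Type*} [Fintype X] [DecidableEq X] [Fintype Y] [DecidableEq Y]
    (F : Perm X →* Perm Y) {e : X → Y} (he : Function.Injective e) (hF : ∀ σ x, F σ (e x) = e (σ x))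
    (hswap : ∀ x y, F (swap x y) = swap (e x) (e y)) (σ : Perm X) :
    reflLength (F σ) = reflLength σ := by
  induction hn : reflLength σ generalizing σ with
  | zero => rw [eq_one_of_reflLength_eq_zero hn, map_one, reflLength_one]
  | succ n ih =>
    obtain ⟨x, hx⟩ : ∃ x, σ x ≠ x := by
      by_contra! hcon
      have : σ = 1 := Perm.ext hcon
      rw [this, reflLength_one] at hn
      omega
    have h1 := reflLength_swap_mul_delete hx
    have h2 := reflLength_swap_mul_delete (σ := F σ) (x := e x)
      (by rw [hF]; exact fun h => hx (he h))
    rw [hF, ← hswap, ← map_mul] at h2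
    have h3 := ih (swap x (σ x) * σ) (by omega)
    omega

variable {V : Type*}

/-- The permutation of the pairs `(v, w)` that acts on those with first entry `v` by `f v`. -/
def vertexPerm : (V → Perm V) →* Perm (V × V) where
  toFun f := Equiv.prodShear (Equiv.refl V) f
  map_one' := rfl
  map_mul' _ _ := rfl

@[simp]
theorem vertexPerm_apply (f : V → Perm V) (d : V × V) : vertexPerm f d = (d.1, f d.1 d.2) := rfl

theorem vertexPerm_pow_apply (f : V → Perm V) (d : V × V) (k : ℕ) :
    (vertexPerm f ^ k) d = (d.1, (f d.1 ^ k) d.2) := by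
  rw [← map_pow]
  rfl

theorem vertexPerm_inv_apply (f : V → Perm V) (d : V × V) :
    (vertexPerm f)⁻¹ d = (d.1, (f d.1)⁻¹ d.2) := by
  rw [← map_inv]
  rfl

variable [DecidableEq V]

theorem vertexPerm_mulSingle_apply_of_ne {v : V} (σ : Perm V) {d : V × V} (h : d.1 ≠ v) :
    vertexPerm (Pi.mulSingle v σ) d = d := by
  rw [vertexPerm_apply, Pi.mulSingle_eq_of_ne h]
  rfl

theorem vertexPerm_mulSingle_apply (v w : V) (σ : Perm V) :
    vertexPerm (Pi.mulSingle v σ) (v, w) = (v, σ w) := by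
  rw [vertexPerm_apply, Pi.mulSingle_eq_same]

variable [Fintype V]

theorem reflLength_vertexPerm_mulSingle (v : V) (σ : Perm V) :
    reflLength (vertexPerm (Pi.mulSingle v σ)) = reflLength σ := by
  refine reflLength_map (vertexPerm.comp (MonoidHom.mulSingle (fun _ : V => Perm V) v))
    (e := fun w => (v, w)) (fun a b h => (Prod.mk.inj h).2)
    (fun σ w => vertexPerm_mulSingle_apply v w σ) (fun x y => ?_) σ
  ext1 ⟨a, b⟩
  by_cases ha : a = v
  · subst ha
    refine (vertexPerm_mulSingle_apply a b _).trans ?_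
    simp only [swap_apply_def, Prod.mk.injEq, true_and]
    split_ifs <;> rfl
  · refine (vertexPerm_mulSingle_apply_of_ne _ ha).trans ?_
    rw [swap_apply_of_ne_of_ne] <;> simp [ha]

theorem reflLength_vertexPerm_le (f : V → Perm V) :
    reflLength (vertexPerm f) ≤ ∑ v, reflLength (f v) := by
  have h : IsDisjointJoin Finset.univ (fun v => vertexPerm (Pi.mulSingle v (f v)))
      (vertexPerm f) := by
    rintro ⟨a, b⟩
    left
    refine ⟨a, Finset.mem_univ a, (vertexPerm_mulSingle_apply a b (f a)).symm, fun j _ hj => ?_⟩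
    exact ⟨vertexPerm_mulSingle_apply_of_ne _ (Ne.symm hj),
      vertexPerm_mulSingle_apply_of_ne _ (Ne.symm hj)⟩
  simpa only [reflLength_vertexPerm_mulSingle] using h.reflLength_le

end VertexPerm

/-! ### Directed edges and their reversal. -/

section Darts

open Equiv Equiv.Perm

variable {V : Type*} {G : SimpleGraph V}

open Classical in
/-- The neighbours of `v` in the subgraph `S`. -/
noncomputable def neighbors [Fintype V] (S : G.Subgraph) (v : V) : Finset V :=
  Finset.univ.filter fun w => S.Adj v w

@[simp]
theorem mem_neighbors [Fintype V] {S : G.Subgraph} {v w : V} :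
    w ∈ neighbors S v ↔ S.Adj v w := by
  simp [neighbors]

theorem coe_neighbors [Fintype V] (S : G.Subgraph) (v : V) :
    (neighbors S v : Set V) = S.neighborSet v := by
  ext w
  simp

theorem card_neighbors [Fintype V] (S : G.Subgraph) (v : V) : (neighbors S v).card = deg S v := by
  rw [deg, ← coe_neighbors, Set.ncard_coe_finset]

open Classical in
/-- The reversal of the directed edges of `S`. -/
noncomputable def dartFlip (S : G.Subgraph) : Perm (V × V) :=
  Function.Involutive.toPerm (fun d => if S.Adj d.1 d.2 then d.swap else d) <| by
    rintro ⟨a, b⟩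
    by_cases h : S.Adj a b
    · simp [h, h.symm]
    · simp [h]

theorem dartFlip_of_adj {S : G.Subgraph} {a b : V} (h : S.Adj a b) :
    dartFlip S (a, b) = (b, a) := if_pos h

theorem dartFlip_of_not_adj {S : G.Subgraph} {a b : V} (h : ¬ S.Adj a b) :
    dartFlip S (a, b) = (a, b) := if_neg h

/-- The number of pairs of vertices that are not directed edges of `S`. -/
noncomputable def numNonDarts (S : G.Subgraph) : ℕ :=
  Nat.card {d : V × V // ¬ S.Adj d.1 d.2}

theorem card_darts [Finite V] (S : G.Subgraph) :
    Nat.card {d : V × V // S.Adj d.1 d.2} = 2 * S.edgeSet.ncard := by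
  classical
  have := Fintype.ofFinite V
  have h1 := S.spanningCoe.dart_card_eq_twice_card_edges
  have h2 : Nat.card {d : V × V // S.Adj d.1 d.2} = Fintype.card S.spanningCoe.Dart := by
    rw [← Nat.card_eq_fintype_card]
    exact Nat.card_congr
      { toFun d := ⟨d.1, d.2⟩
        invFun d := ⟨d.1, d.2⟩
        left_inv _ := rfl
        right_inv _ := rfl }
  rw [h2, h1, ← Set.ncard_coe_finset, SimpleGraph.coe_edgeFinset,
    SimpleGraph.Subgraph.edgeSet_spanningCoe]

theorem card_pairs [Finite V] (S : G.Subgraph) :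
    Nat.card (V × V) = 2 * S.edgeSet.ncard + numNonDarts S := by
  classical
  rw [← card_darts, numNonDarts, ← Nat.card_sum]
  exact Nat.card_congr (Equiv.sumCompl _).symm

theorem reflLength_dartFlip_le [Fintype V] (S : G.Subgraph) :
    reflLength (dartFlip S) ≤ S.edgeSet.ncard := by
  classical
  have hinv : ∀ d e : V × V, SameCycle (dartFlip S) d e → s(d.1, d.2) = s(e.1, e.2) := by
    have : SameCycle.setoid (dartFlip S) ≤ Setoid.ker fun d : V × V => s(d.1, d.2) := by
      refine sameCycleSetoid_le_iff.2 ?_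
      rintro ⟨a, b⟩
      rw [Setoid.ker_def]
      by_cases h : S.Adj a b
      · rw [dartFlip_of_adj h]
        exact Sym2.eq_swap
      · rw [dartFlip_of_not_adj h]
    exact fun d e h => this h
  have hout : ∀ e : S.edgeSet, s((Quot.out e.1).1, (Quot.out e.1).2) = e.1 := fun e =>
    Quot.out_eq e.1
  have hadj : ∀ e : S.edgeSet, S.Adj (Quot.out e.1).1 (Quot.out e.1).2 := fun e => by
    rw [← SimpleGraph.Subgraph.mem_edgeSet, hout]
    exact e.2
  have hfix : ∀ d : V × V, ¬ S.Adj d.1 d.2 → ∀ e, SameCycle (dartFlip S) d e → d = e :=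
    fun d hd e hde => hde.eq_of_left (dartFlip_of_not_adj hd)
  have h1 := reflLength_add_card_le (Y := {d : V × V // ¬ S.Adj d.1 d.2} ⊕ S.edgeSet) (dartFlip S)
    (Sum.elim Subtype.val fun e => Quot.out e.1) <| by
      rintro (⟨d, hd⟩ | e) (⟨d', hd'⟩ | e') h
      · simpa using hfix d hd d' h
      · have : d = Quot.out e'.1 := hfix d hd _ h
        exact absurd (hadj e') (this ▸ hd)
      · have : d' = Quot.out e.1 := hfix d' hd' _ h.symm
        exact absurd (hadj e) (this ▸ hd')
      · have := hinv _ _ h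
        simp only [Sum.elim_inr, hout] at this
        exact congrArg Sum.inr (Subtype.ext this)
  rw [Nat.card_sum, card_pairs S, numNonDarts, Nat.card_coe_set_eq] at h1
  omega

end Darts

/-! ### Faces and Euler's formula in terms of reflection length. -/

namespace RotationSystem

open Equiv Equiv.Perm

variable {V : Type*} {G : SimpleGraph V} {S : G.Subgraph}

/-- The face permutation, as a permutation of all pairs of vertices that fixes those that are not
directed edges. -/
noncomputable def facePerm (π : RotationSystem S) : Perm (V × V) :=
  (vertexPerm π.rot)⁻¹ * dartFlip S

theorem adj_rot_inv (π : RotationSystem S) {a b : V} : S.Adj a ((π.rot a)⁻¹ b) ↔ S.Adj a b :=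
  ((isCycleOn_inv.2 (π.isCycleOn a)).apply_mem_iff (x := b))

theorem facePerm_of_adj (π : RotationSystem S) {a b : V} (h : S.Adj a b) :
    π.facePerm (a, b) = (b, (π.rot b)⁻¹ a) := by
  rw [facePerm, Perm.mul_apply, dartFlip_of_adj h, vertexPerm_inv_apply]

theorem facePerm_of_not_adj (π : RotationSystem S) {a b : V} (h : ¬ S.Adj a b) :
    π.facePerm (a, b) = (a, b) := by
  rw [facePerm, Perm.mul_apply, dartFlip_of_not_adj h, vertexPerm_inv_apply,
    Perm.inv_eq_iff_eq.2 (π.fixed a b h).symm]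

variable [Fintype V]

/-- The two permutations agree on directed edges, which they preserve; they may differ on other
pairs, which `faceStep` reverses. -/
theorem sameCycle_faceStep_iff (π : RotationSystem S) {d e : V × V} (hd : S.Adj d.1 d.2) :
    SameCycle π.faceStep d e ↔ SameCycle π.facePerm d e := by
  classical
  have key : ∀ k : ℕ, (π.faceStep ^ k) d = (π.facePerm ^ k) d ∧
      S.Adj ((π.facePerm ^ k) d).1 ((π.facePerm ^ k) d).2 := by
    intro k
    induction k with
    | zero => exact ⟨rfl, hd⟩
    | succ k ih =>
      obtain ⟨h1, h2⟩ := ih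
      rw [pow_succ', pow_succ', Perm.mul_apply, Perm.mul_apply, h1]
      set c := (π.facePerm ^ k) d
      rw [show π.facePerm c = (c.2, (π.rot c.2)⁻¹ c.1) from π.facePerm_of_adj h2]
      exact ⟨rfl, π.adj_rot_inv.2 h2.symm⟩
  constructor
  · intro h
    obtain ⟨k, -, -, rfl⟩ := h.exists_pow_eq
    exact ⟨k, by rw [zpow_natCast, (key k).1]⟩
  · intro h
    obtain ⟨k, -, -, rfl⟩ := h.exists_pow_eq
    exact ⟨k, by rw [zpow_natCast, (key k).1]⟩

/-- The orbits are the face boundaries and one singleton for each pair that is not a directed edge.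
-/
theorem reflLength_facePerm_add (π : RotationSystem S) :
    reflLength π.facePerm + π.faceBoundaries.ncard = 2 * S.edgeSet.ncard := by
  classical
  let cls : V × V → Set (V × V) := fun d => {e | SameCycle π.facePerm d e}
  have h1 : π.faceBoundaries = cls '' {d | S.Adj d.1 d.2} := by
    ext O
    simp only [faceBoundaries, Set.mem_ofPred_eq, Set.mem_image]
    refine exists_congr fun d => and_congr_right fun hd => ?_
    have : cls d = {e | SameCycle π.faceStep d e} := by
      ext e
      exact (π.sameCycle_faceStep_iff hd).symm
    rw [this, eq_comm]
  have hcls : ∀ d, ¬ S.Adj d.1 d.2 → cls d = {d} := by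
    intro d hd
    ext e
    constructor
    · intro h
      exact (h.eq_of_left (π.facePerm_of_not_adj hd)).symm
    · rintro rfl
      exact SameCycle.refl _ _
  have h2 : (cls '' {d | ¬ S.Adj d.1 d.2}).ncard = numNonDarts S := by
    rw [Set.InjOn.ncard_image]
    · rfl
    · intro d hd e he hde
      rw [hcls d hd, hcls e he] at hde
      exact Set.singleton_injective hde
  have h3 : orbitCount π.facePerm = (Set.range cls).ncard := by
    rw [orbitCount, ← Nat.card_coe_set_eq]
    have : SameCycle.setoid π.facePerm = Setoid.ker cls := by
      ext d e
      rw [Setoid.ker_def]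
      constructor
      · intro h
        ext c
        exact ⟨fun h' => h.symm.trans h', fun h' => h.trans h'⟩
      · intro h
        have : e ∈ cls d := h ▸ SameCycle.refl _ _
        exact this
    rw [this]
    exact Nat.card_congr (Setoid.quotientKerEquivRange cls)
  have h4 : Set.range cls = cls '' {d | S.Adj d.1 d.2} ∪ cls '' {d | ¬ S.Adj d.1 d.2} := by
    rw [← Set.image_union, ← Set.image_univ]
    congr 1
    ext d
    simp [em]
  have h5 : Disjoint (cls '' {d | S.Adj d.1 d.2}) (cls '' {d | ¬ S.Adj d.1 d.2}) := by
    rw [Set.disjoint_left]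
    rintro _ ⟨d, hd, rfl⟩ ⟨e, he, hde⟩
    rw [hcls e he] at hde
    have : d ∈ ({e} : Set (V × V)) := hde ▸ SameCycle.refl _ _
    rw [Set.mem_singleton_iff] at this
    exact he (this ▸ hd)
  rw [h4, Set.ncard_union_eq h5, ← h1, h2] at h3
  have h6 := reflLength_add_orbitCount π.facePerm
  have h7 := card_pairs S
  omega

/-- An edge guarantees a face boundary, so the convention for edgeless graphs in `numFaces` plays no
role. -/
theorem isPlanar_iff (π : RotationSystem S) {a b : V} (h : S.Adj a b) :
    π.IsPlanar ↔ reflLength π.facePerm + 2 = S.verts.ncard + S.edgeSet.ncard := by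
  have h1 := π.reflLength_facePerm_add
  have h2 : 0 < π.faceBoundaries.ncard := by
    rw [Set.ncard_pos]
    exact ⟨_, (a, b), h, rfl⟩
  rw [IsPlanar, numFaces, max_eq_right (by omega)]
  omega

theorem reflLength_rot_add_one [DecidableEq V] (π : RotationSystem S) {v w : V} (h : S.Adj v w) :
    reflLength (π.rot v) + 1 = deg S v := by
  rw [← card_neighbors]
  refine reflLength_add_one_of_isCycleOn ⟨w, mem_neighbors.2 h⟩ ?_ fun x hx => ?_
  · rw [coe_neighbors]
    exact π.isCycleOn v
  · exact π.fixed v x fun h => hx (mem_neighbors.2 h)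

end RotationSystem

end PlanarBlocks

/-! ## Planarity is a local condition at the vertices -/

namespace PlanarBlocks

open Equiv Equiv.Perm

/-! ### Joining and restricting permutations. -/

section Join

variable {X ι : Type*}

theorem pow_apply_congr {σ τ : Perm X} {A : Set X} (hA : ∀ x ∈ A, τ x ∈ A)
    (h : ∀ x ∈ A, σ x = τ x) {x : X} (hx : x ∈ A) (k : ℕ) :
    (σ ^ k) x = (τ ^ k) x ∧ (τ ^ k) x ∈ A := by
  induction k with
  | zero => exact ⟨rfl, hx⟩
  | succ k ih =>
    obtain ⟨h1, h2⟩ := ih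
    rw [pow_succ', pow_succ', Perm.mul_apply, Perm.mul_apply, h1]
    exact ⟨h _ h2, hA _ h2⟩

theorem isCycleOn_congr [Fintype X] [DecidableEq X] {σ τ : Perm X} {A : Set X}
    (hτ : τ.IsCycleOn A) (h : ∀ x ∈ A, σ x = τ x) : σ.IsCycleOn A := by
  have hA : ∀ x ∈ A, τ x ∈ A := fun x hx => hτ.1.mapsTo hx
  refine isCycleOn_iff.2 ⟨fun a ha => h a ha ▸ hA a ha, fun a ha b hb => ?_⟩
  obtain ⟨k, -, -, rfl⟩ := (hτ.2 ha hb).exists_pow_eq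
  exact ⟨k, by rw [zpow_natCast, (pow_apply_congr hA h ha k).1]⟩

theorem exists_perm_join (T : Finset ι) (τ : ι → Perm X) (A : ι → Set X)
    (hA : ∀ i ∈ T, ∀ x, τ i x ∈ A i ↔ x ∈ A i) (hfix : ∀ i ∈ T, ∀ x ∉ A i, τ i x = x)
    (hdisj : ∀ i ∈ T, ∀ j ∈ T, ∀ x, x ∈ A i → x ∈ A j → i = j) :
    ∃ σ : Perm X, (∀ i ∈ T, ∀ x ∈ A i, σ x = τ i x) ∧ ∀ x, (∀ i ∈ T, x ∉ A i) → σ x = x := by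
  classical
  induction T using Finset.induction_on with
  | empty => exact ⟨1, by simp, fun x _ => rfl⟩
  | insert i T hi ih =>
    obtain ⟨σ, h1, h2⟩ := ih (fun j hj => hA j (Finset.mem_insert_of_mem hj))
      (fun j hj => hfix j (Finset.mem_insert_of_mem hj))
      (fun j hj k hk => hdisj j (Finset.mem_insert_of_mem hj) k (Finset.mem_insert_of_mem hk))
    have hiT := Finset.mem_insert_self i T
    refine ⟨τ i * σ, fun j hj x hx => ?_, fun x hx => ?_⟩
    · rcases Finset.mem_insert.1 hj with rfl | hjT
      · rw [Perm.mul_apply, h2 x fun k hk hxk => ?_]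
        obtain rfl := hdisj j hiT k (Finset.mem_insert_of_mem hk) x hx hxk
        exact hi hk
      · rw [Perm.mul_apply, h1 j hjT x hx]
        refine hfix i hiT _ fun hmem => ?_
        obtain rfl := hdisj i hiT j hj _ hmem ((hA j hj x).2 hx)
        exact hi hjT
    · rw [Perm.mul_apply, h2 x fun j hj => hx j (Finset.mem_insert_of_mem hj)]
      exact hfix i hiT x (hx i hiT)

/-- The part of the permutation `σ` that acts on an invariant set `A`. -/
theorem exists_restrict [Finite X] (σ : Perm X) {A : Set X} (hA : ∀ x ∈ A, σ x ∈ A) :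
    ∃ τ : Perm X, (∀ x ∈ A, τ x = σ x) ∧ ∀ x ∉ A, τ x = x := by
  classical
  have hA' : ∀ x, σ x ∈ A ↔ x ∈ A := by
    have hsub : σ '' A ⊆ A := Set.image_subset_iff.2 hA
    have heq := Set.eq_of_subset_of_ncard_le hsub
      (Set.ncard_image_of_injective A σ.injective).ge (Set.toFinite A)
    intro x
    conv_lhs => rw [← heq]
    exact σ.injective.mem_set_image
  refine ⟨ofSubtype (σ.subtypePerm hA'), fun x hx => ?_, fun x hx => ?_⟩
  · rw [ofSubtype_apply_of_mem _ hx]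
    rfl
  · exact ofSubtype_apply_of_not_mem _ hx

end Join

variable {V : Type*} {G : SimpleGraph V}

/-! ### Unions of blocks and their combined rotations. -/

section BlockUnion

/-- The blocks of `G` that are contained in `S`. -/
noncomputable def blocksIn [Finite V] (S : G.Subgraph) : Finset (Block G) :=
  (Set.toFinite {B : Block G | B.1 ≤ S}).toFinset

/-- The blocks of `G` that are contained in `S` and contain `v`. -/
noncomputable def blocksAt [Finite V] (S : G.Subgraph) (v : V) : Finset (Block G) :=
  (Set.toFinite {B : Block G | B.1 ≤ S ∧ v ∈ B.1.verts}).toFinset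

@[simp]
theorem mem_blocksIn [Finite V] {S : G.Subgraph} {B : Block G} : B ∈ blocksIn S ↔ B.1 ≤ S := by
  simp [blocksIn]

@[simp]
theorem mem_blocksAt [Finite V] {S : G.Subgraph} {v : V} {B : Block G} :
    B ∈ blocksAt S v ↔ B.1 ≤ S ∧ v ∈ B.1.verts := by
  simp [blocksAt]

/-- `S` is connected, has an edge, and is a union of blocks of `G`. -/
structure IsBlockUnion (S : G.Subgraph) : Prop where
  connected : S.Connected
  exists_adj : ∃ a b, S.Adj a b
  exists_block : ∀ a b, S.Adj a b → ∃ B : Block G, B.1 ≤ S ∧ B.1.Adj a b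

theorem IsBlockUnion.adj_of_mem {S : G.Subgraph} (hS : IsBlockUnion S) {v : V}
    (hv : v ∈ S.verts) : ∃ w, S.Adj v w := by
  obtain ⟨a, b, hab⟩ := hS.exists_adj
  have : Nontrivial S.verts := ⟨⟨a, hab.fst_mem⟩, ⟨b, hab.snd_mem⟩, by simpa using hab.ne⟩
  exact hS.connected.preconnected.exists_adj_of_nontrivial ⟨v, hv⟩

theorem IsBlockUnion.block_adj {S : G.Subgraph} (hS : IsBlockUnion S) {B : Block G}
    (hB : B.1 ≤ S) {v : V} (hv : v ∈ B.1.verts) : ∃ w, B.1.Adj v w := by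
  obtain ⟨w, hw⟩ := hS.adj_of_mem (hB.1 hv)
  exact B.2.exists_adj hv hw.adj_sub

/-- The permutations `ρ v` combine the rotations at `v` of the blocks contained in `S`. -/
structure IsBlockRotation (ℰ : ∀ B : Block G, SphereEmbedding B.1) (S : G.Subgraph)
    (ρ : V → Perm V) : Prop where
  apply_eq : ∀ B : Block G, B.1 ≤ S → ∀ v x, B.1.Adj v x → ρ v x = (ℰ B).1.rot v x
  fixed : ∀ v x, ¬ S.Adj v x → ρ v x = x

variable {ℰ : ∀ B : Block G, SphereEmbedding B.1} {S : G.Subgraph} {ρ : V → Perm V}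

variable (ℰ S) in
theorem exists_isBlockRotation [Finite V] :
    ∃ ρ : V → Perm V, IsBlockRotation ℰ S ρ := by
  have h : ∀ v, ∃ σ : Perm V, (∀ B ∈ blocksIn S, ∀ x ∈ B.1.neighborSet v,
      σ x = (ℰ B).1.rot v x) ∧ ∀ x, (∀ B ∈ blocksIn S, x ∉ B.1.neighborSet v) → σ x = x :=
    fun v => exists_perm_join (blocksIn S) (fun B => (ℰ B).1.rot v) (fun B => B.1.neighborSet v)
      (fun B _ x => ((ℰ B).1.isCycleOn v).apply_mem_iff) (fun B _ x hx => (ℰ B).1.fixed v x hx)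
      (fun B _ B' _ x hx hx' => Subtype.ext (B.2.eq_of_adj B'.2 hx hx'))
  choose ρ h1 h2 using h
  refine ⟨ρ, fun B hB v x hx => h1 v B (mem_blocksIn.2 hB) x hx, fun v x hx => h2 v x ?_⟩
  exact fun B hB hBx => hx ((mem_blocksIn.1 hB).2 hBx)

variable [Fintype V] [DecidableEq V]

theorem IsBlockRotation.isCyclePartition (hρ : IsBlockRotation ℰ S ρ) (hS : IsBlockUnion S)
    (v : V) : IsCyclePartition (ρ v) (blocksAt S v) (fun B => neighbors B.1 v)
      (neighbors S v) where
  nonempty B hB := by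
    obtain ⟨h1, h2⟩ := mem_blocksAt.1 hB
    obtain ⟨w, hw⟩ := hS.block_adj h1 h2
    exact ⟨w, mem_neighbors.2 hw⟩
  eq_of_mem B _ B' _ x hx hx' :=
    Subtype.ext (B.2.eq_of_adj B'.2 (mem_neighbors.1 hx) (mem_neighbors.1 hx'))
  mem_iff x := by
    simp only [mem_neighbors, mem_blocksAt]
    constructor
    · intro h
      obtain ⟨B, hB, hBx⟩ := hS.exists_block v x h
      exact ⟨B, ⟨hB, hBx.fst_mem⟩, hBx⟩
    · rintro ⟨B, ⟨hB, -⟩, hBx⟩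
      exact hB.2 hBx
  isCycleOn B hB := by
    rw [coe_neighbors]
    exact isCycleOn_congr ((ℰ B).1.isCycleOn v)
      fun x hx => hρ.apply_eq B (mem_blocksAt.1 hB).1 v x hx
  fixed x hx := hρ.fixed v x fun h => hx (mem_neighbors.2 h)

omit [DecidableEq V] in
theorem sum_ite_mem_eq_ncard (s : Set V) [DecidablePred (· ∈ s)] :
    (∑ v, if v ∈ s then 1 else 0) = s.ncard := by
  rw [Finset.sum_boole, Set.ncard_eq_toFinset_card', Nat.cast_id]
  congr 1
  ext v
  simp

omit [DecidableEq V] in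
theorem sum_deg (S : G.Subgraph) : ∑ v, deg S v = 2 * S.edgeSet.ncard := by
  rw [← card_darts, Nat.card_congr (β := Σ v, {w // S.Adj v w})
    { toFun d := ⟨d.1.1, d.1.2, d.2⟩
      invFun q := ⟨(q.1, q.2.1), q.2.2⟩
      left_inv _ := rfl
      right_inv _ := rfl }, Nat.card_sigma]
  rfl

theorem RotationSystem.sum_reflLength_rot (hS : IsBlockUnion S) (π : RotationSystem S) :
    ∑ v, reflLength (π.rot v) + S.verts.ncard = 2 * S.edgeSet.ncard := by
  classical
  rw [← sum_deg, ← sum_ite_mem_eq_ncard, ← Finset.sum_add_distrib]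
  refine Finset.sum_congr rfl fun v _ => ?_
  by_cases hv : v ∈ S.verts
  · obtain ⟨w, hw⟩ := hS.adj_of_mem hv
    rw [if_pos hv, π.reflLength_rot_add_one hw]
  · have hnone : S.neighborSet v = ∅ := by
      ext w
      simp only [SimpleGraph.Subgraph.mem_neighborSet, Set.mem_empty_iff_false, iff_false]
      exact fun h => hv h.fst_mem
    have : π.rot v = 1 := by
      ext w
      exact π.fixed v w (by simp [hnone])
    rw [if_neg hv, this, reflLength_one, deg, hnone, Set.ncard_empty]

/-- Only the rotations along the walk matter, so `f` may be trivial at a vertex that the walk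
avoids; this is what the splitting of a vertex needs. -/
theorem RotationSystem.setoid_of_walk (π : RotationSystem S) {f : V → Perm V}
    {t : Setoid (V × V)} (hf : SameCycle.setoid (vertexPerm f) ≤ t)
    (hflip : SameCycle.setoid (dartFlip S) ≤ t) {a c : V} (p : G.Walk a c)
    (hp : p.toSubgraph ≤ S) (hfp : ∀ w ∈ p.support, f w = π.rot w) {b d : V} (hab : S.Adj a b)
    (hcd : S.Adj c d) : t (a, b) (c, d) := by
  have hsame : ∀ a b d, f a = π.rot a → S.Adj a b → S.Adj a d → t (a, b) (a, d) := by
    intro a b d hfa hab had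
    refine hf ?_
    obtain ⟨k, -, -, hk⟩ := ((π.isCycleOn a).2 hab had).exists_pow_eq
    refine ⟨k, ?_⟩
    rw [zpow_natCast, vertexPerm_pow_apply]
    simp only [hfa, hk]
  induction p generalizing b with
  | nil => exact hsame _ _ _ (hfp _ (by simp)) hab hcd
  | @cons a a' c h p ih =>
    have haa' : S.Adj a a' := hp.2 (.inl (by simp))
    have h1 := hsame a b a' (hfp _ (by simp)) hab haa'
    have h2 : t (a, a') (a', a) := hflip (by
      have := sameCycle_apply (dartFlip S) (a, a')
      rwa [dartFlip_of_adj haa'] at this)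
    have h3 := ih (le_trans le_sup_right hp) (fun w hw => hfp w (by simp [hw])) haa'.symm hcd
    exact t.trans h1 (t.trans h2 h3)

/-- The genus is nonnegative: by connectedness all directed edges lie in one common orbit of
rotation and reversal. -/
theorem RotationSystem.le_reflLength_facePerm (hS : IsBlockUnion S) (π : RotationSystem S) :
    S.verts.ncard + S.edgeSet.ncard ≤ reflLength π.facePerm + 2 := by
  classical
  obtain ⟨a, b, hab⟩ := hS.exists_adj
  have h1 := genus_inequality (Y := {d : V × V // ¬ S.Adj d.1 d.2} ⊕ Unit) (vertexPerm π.rot)⁻¹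
    (dartFlip S) (Sum.elim Subtype.val fun _ => (a, b)) <| by
      rintro ⟨c, d⟩
      by_cases hcd : S.Adj c d
      · refine ⟨.inr (), fun t h1 h2 => ?_⟩
        obtain ⟨p, hp⟩ := (S.preconnected_iff_forall_exists_walk_subgraph.1
          hS.connected.preconnected) hab.fst_mem hcd.fst_mem
        refine π.setoid_of_walk (f := π.rot) (le_trans ?_ h1) h2 p hp (fun _ _ => rfl) hab hcd
        exact fun x y hxy => sameCycle_inv.2 hxy
      · exact ⟨.inl ⟨(c, d), hcd⟩, fun t _ _ => t.refl _⟩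
  rw [reflLength_inv, Nat.card_sum, card_pairs S, Nat.card_unique (α := Unit)] at h1
  have h2 := reflLength_vertexPerm_le π.rot
  have h3 := π.sum_reflLength_rot hS
  have h4 := reflLength_dartFlip_le S
  have h5 : numNonDarts S = Nat.card {d : V × V // ¬ S.Adj d.1 d.2} := rfl
  rw [← RotationSystem.facePerm] at h1
  omega

end BlockUnion

end PlanarBlocks

namespace PlanarBlocks

open Equiv Equiv.Perm

variable {V : Type*} {G : SimpleGraph V} [Fintype V] [DecidableEq V]
  {ℰ : ∀ B : Block G, SphereEmbedding B.1} {S : G.Subgraph} {ρ : V → Perm V}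

/-! ### Planarity with prescribed blocks versus geodesics at the vertices. -/

namespace RotationSystem

/-- The faces of the map obtained by splitting `v` into vertices of degree one. -/
theorem le_reflLength_split (hS : IsBlockUnion S) (π : RotationSystem S) {v : V}
    (hv : v ∈ S.verts) :
    S.verts.ncard + S.edgeSet.ncard + deg S v ≤ 1 + 2 * (blocksAt S v).card +
      reflLength ((vertexPerm (Function.update π.rot v 1))⁻¹ * dartFlip S) := by
  classical
  set f := Function.update π.rot v 1 with hf
  have hfne : ∀ w, w ≠ v → f w = π.rot w := fun w hw => Function.update_of_ne hw _ _
  have hinvle : SameCycle.setoid (vertexPerm f) ≤ SameCycle.setoid (vertexPerm f)⁻¹ :=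
    fun x y hxy => sameCycle_inv.2 hxy
  have hrep : ∀ B : blocksAt S v, ∃ w, B.1.1.Adj v w := fun B =>
    hS.block_adj (mem_blocksAt.1 B.2).1 (mem_blocksAt.1 B.2).2
  choose r hr using hrep
  -- The split map has at most one component per block at `v`: a block stays connected without `v`,
  -- and every other directed edge is joined to a neighbour of `v` by a walk avoiding `v`.
  have h1 := genus_inequality (Y := {d : V × V // ¬ S.Adj d.1 d.2} ⊕ blocksAt S v)
    (vertexPerm f)⁻¹ (dartFlip S) (Sum.elim Subtype.val fun B => (v, r B)) <| by
      have hatv : ∀ u, S.Adj v u → ∃ B : blocksAt S v, ∀ t : Setoid (V × V),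
          SameCycle.setoid (vertexPerm f)⁻¹ ≤ t → SameCycle.setoid (dartFlip S) ≤ t →
          t (v, r B) (v, u) := by
        intro u hu
        obtain ⟨B, hB, hBu⟩ := hS.exists_block v u hu
        refine ⟨⟨B, mem_blocksAt.2 ⟨hB, hBu.fst_mem⟩⟩, fun t h1 h2 => ?_⟩
        set B' : blocksAt S v := ⟨B, mem_blocksAt.2 ⟨hB, hBu.fst_mem⟩⟩
        have hrB : B.1.Adj v (r B') := hr B'
        obtain ⟨p, hp, hvp⟩ :=
          B.2.joinedAvoiding hrB.snd_mem hBu.snd_mem hrB.ne.symm hBu.ne.symm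
        have h3 := π.setoid_of_walk (f := f)
          (hinvle.trans h1) h2 p (hp.trans hB)
          (fun w hw => hfne w (by rintro rfl; exact hvp hw)) (hB.2 hrB).symm hu.symm
        have h4 : ∀ w, S.Adj v w → t (v, w) (w, v) := fun w hw => h2 (by
          have := sameCycle_apply (dartFlip S) (v, w)
          rwa [dartFlip_of_adj hw] at this)
        exact t.trans (h4 _ (hB.2 hrB)) (t.trans h3 (t.symm (h4 _ hu)))
      rintro ⟨c, d⟩
      by_cases hcd : S.Adj c d
      · by_cases hcv : c = v
        · subst hcv
          obtain ⟨B, hB⟩ := hatv d hcd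
          exact ⟨.inr B, hB⟩
        · obtain ⟨q, hq⟩ := (S.preconnected_iff_forall_exists_walk_subgraph.1
            hS.connected.preconnected) hcd.fst_mem hv
          obtain ⟨b, hb, p, hp, hvp⟩ := exists_adj_joinedAvoiding q hq hcv
          obtain ⟨B, hB⟩ := hatv b hb.symm
          refine ⟨.inr B, fun t h1 h2 => t.trans (hB t h1 h2) ?_⟩
          have h3 := π.setoid_of_walk (f := f)
            (hinvle.trans h1) h2 p hp
            (fun w hw => hfne w (by rintro rfl; exact hvp hw)) hcd hb
          have h4 : t (v, b) (b, v) := h2 (by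
            have := sameCycle_apply (dartFlip S) (v, b)
            rwa [dartFlip_of_adj hb.symm] at this)
          exact t.trans h4 (t.symm h3)
      · exact ⟨.inl ⟨(c, d), hcd⟩, fun t _ _ => t.refl _⟩
  rw [reflLength_inv, Nat.card_sum, card_pairs S, Nat.card_eq_fintype_card (α := blocksAt S v),
    Fintype.card_coe] at h1
  have h0 : numNonDarts S = Nat.card {d : V × V // ¬ S.Adj d.1 d.2} := rfl
  have h2 := reflLength_vertexPerm_le f
  have h3 := π.sum_reflLength_rot hS
  have h4 := reflLength_dartFlip_le S
  obtain ⟨w, hw⟩ := hS.adj_of_mem hv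
  have h5 := π.reflLength_rot_add_one hw
  rw [← Finset.add_sum_erase _ _ (Finset.mem_univ v)] at h2 h3
  have h6 : ∑ w ∈ Finset.univ.erase v, reflLength (f w) =
      ∑ w ∈ Finset.univ.erase v, reflLength (π.rot w) :=
    Finset.sum_congr rfl fun w hw => by rw [hfne w (Finset.ne_of_mem_erase hw)]
  have h7 : reflLength (f v) = 0 := by rw [hf, Function.update_self, reflLength_one]
  omega

omit [DecidableEq V] in
theorem isDisjointJoin_neighbors (hρ : IsBlockRotation ℰ S ρ) (hS : IsBlockUnion S) (v : V) :
    IsDisjointJoin (blocksAt S v) (fun B => (ℰ B).1.rot v) (ρ v) := by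
  intro x
  by_cases hx : S.Adj v x
  · obtain ⟨B, hB, hBx⟩ := hS.exists_block v x hx
    left
    refine ⟨B, mem_blocksAt.2 ⟨hB, hBx.fst_mem⟩, hρ.apply_eq B hB v x hBx, fun B' _ hne => ?_⟩
    have hnot : ∀ y, B.1.Adj v y → ¬ B'.1.Adj v y := fun y hy hy' =>
      hne (Subtype.ext (B'.2.eq_of_adj B.2 hy' hy))
    refine ⟨(ℰ B').1.fixed v x (hnot x hBx), (ℰ B').1.fixed v _ (hnot _ ?_)⟩
    rw [hρ.apply_eq B hB v x hBx]
    exact ((ℰ B).1.isCycleOn v).1.mapsTo hBx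
  · right
    exact ⟨hρ.fixed v x hx, fun B hB => (ℰ B).1.fixed v x fun h =>
      hx ((mem_blocksAt.1 hB).1.2 h)⟩

theorem sum_reflLength_blocks (hρ : IsBlockRotation ℰ S ρ) (hS : IsBlockUnion S) (v : V) :
    ∑ B ∈ blocksAt S v, reflLength ((ℰ B).1.rot v) + (blocksAt S v).card = deg S v := by
  rw [← card_neighbors, (hρ.isCyclePartition hS v).card_eq, Finset.card_eq_sum_ones,
    ← Finset.sum_add_distrib]
  refine Finset.sum_congr rfl fun B hB => ?_
  obtain ⟨w, hw⟩ := hS.block_adj (mem_blocksAt.1 hB).1 (mem_blocksAt.1 hB).2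
  rw [(ℰ B).1.reflLength_rot_add_one hw, card_neighbors]

/-- The block rotations at `v` have total length `deg S v - (blocksAt S v).card`, so the hypothesis
is exactly the geodesic condition, and first returns to each block are its own rotation. -/
theorem restrictsTo_of_local (hρ : IsBlockRotation ℰ S ρ) (hS : IsBlockUnion S)
    (π : RotationSystem S)
    (h : ∀ v ∈ S.verts, reflLength ((ρ v)⁻¹ * π.rot v) + 1 = (blocksAt S v).card)
    {B : Block G} (hB : B.1 ≤ S) : π.RestrictsTo (ℰ B).1 := by
  intro v u hu
  have hBu : B.1.Adj v u := hu
  have hBv := mem_blocksAt.2 ⟨hB, hBu.fst_mem⟩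
  have h1 := h v (hB.1 hBu.fst_mem)
  have h2 := sum_reflLength_blocks hρ hS v
  have h3 := π.reflLength_rot_add_one (hB.2 hBu)
  have h4 := (isDisjointJoin_neighbors hρ hS v).firstReturn_of_geodesic (π := π.rot v)
    (by omega) hBv (A := neighbors B.1 v) (fun x hx => (ℰ B).1.fixed v x fun h' =>
      hx (mem_neighbors.2 h')) (by rw [(ℰ B).1.reflLength_rot_add_one hBu, card_neighbors])
    u (mem_neighbors.2 hBu)
  rwa [coe_neighbors] at h4

-- With the rotations `ρ`, the successor of a directed edge stays in its block, so each face walk is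
-- one of a single block.
omit [DecidableEq V] in
theorem isDisjointJoin_facePerm (hρ : IsBlockRotation ℰ S ρ) (hS : IsBlockUnion S) :
    IsDisjointJoin (blocksIn S) (fun B => (ℰ B).1.facePerm)
      ((vertexPerm ρ)⁻¹ * dartFlip S) := by
  rintro ⟨a, b⟩
  by_cases hab : S.Adj a b
  · obtain ⟨B, hB, hBab⟩ := hS.exists_block a b hab
    have hrot : (ρ b)⁻¹ a = ((ℰ B).1.rot b)⁻¹ a := by
      rw [Perm.inv_eq_iff_eq, hρ.apply_eq B hB b _ ((ℰ B).1.adj_rot_inv.2 hBab.symm)]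
      exact (Perm.eq_inv_iff_eq.1 rfl).symm
    have heq : ((vertexPerm ρ)⁻¹ * dartFlip S) (a, b) = (ℰ B).1.facePerm (a, b) := by
      rw [Perm.mul_apply, dartFlip_of_adj hab, vertexPerm_inv_apply, facePerm_of_adj _ hBab, hrot]
    left
    refine ⟨B, mem_blocksIn.2 hB, heq, fun B' _ hne => ?_⟩
    have hnot : ∀ x y, B.1.Adj x y → ¬ B'.1.Adj x y := fun x y h h' =>
      hne (Subtype.ext (B'.2.eq_of_adj B.2 h' h))
    rw [heq, facePerm_of_adj _ hBab]
    exact ⟨facePerm_of_not_adj _ (hnot _ _ hBab),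
      facePerm_of_not_adj _ (hnot _ _ ((ℰ B).1.adj_rot_inv.2 hBab.symm))⟩
  · right
    refine ⟨?_, fun B hB => facePerm_of_not_adj _ fun h => hab ((mem_blocksIn.1 hB).2 h)⟩
    rw [Perm.mul_apply, dartFlip_of_not_adj hab, vertexPerm_inv_apply,
      Perm.inv_eq_iff_eq.2 (hρ.fixed a b hab).symm]

omit [DecidableEq V] in
theorem sum_card_blocksAt (S : G.Subgraph) :
    ∑ v, (blocksAt S v).card = ∑ B ∈ blocksIn S, B.1.verts.ncard := by
  classical
  have h1 : ∀ v, (blocksAt S v).card = ∑ B ∈ blocksIn S, if v ∈ B.1.verts then 1 else 0 := by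
    intro v
    rw [Finset.sum_boole, Nat.cast_id]
    congr 1
    ext B
    simp
  rw [Finset.sum_congr rfl fun v _ => h1 v, Finset.sum_comm]
  exact Finset.sum_congr rfl fun B _ => sum_ite_mem_eq_ncard _

omit [DecidableEq V] in
theorem sum_ncard_edgeSet_le (S : G.Subgraph) :
    ∑ B ∈ blocksIn S, B.1.edgeSet.ncard ≤ S.edgeSet.ncard := by
  classical
  have h1 : ∀ B : Block G, B.1.edgeSet.ncard = B.1.edgeSet.toFinset.card :=
    fun B => Set.ncard_eq_toFinset_card' _
  rw [Finset.sum_congr rfl fun B _ => h1 B, ← Finset.card_biUnion, Set.ncard_eq_toFinset_card']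
  · refine Finset.card_le_card fun e he => ?_
    obtain ⟨B, hB, he⟩ := Finset.mem_biUnion.1 he
    rw [Set.mem_toFinset] at he ⊢
    exact SimpleGraph.Subgraph.edgeSet_mono (mem_blocksIn.1 hB) he
  · intro B _ B' _ hne
    refine Finset.disjoint_left.2 fun e he he' => hne (Subtype.ext ?_)
    rw [Set.mem_toFinset] at he he'
    induction e with
    | h a b => exact B.2.eq_of_adj B'.2 he he'

/-- The face permutation is a correction at the vertices times the join of the block face
permutations. The correction has length at most the sum of the `b(v) - 1`, and each block
contributes its numbers of vertices and edges minus two; the tree inequality bounds the total by the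
genus-zero value. -/
theorem isPlanar_of_local (hG : G.Connected) (hρ : IsBlockRotation ℰ S ρ) (hS : IsBlockUnion S)
    (π : RotationSystem S)
    (h : ∀ v ∈ S.verts, reflLength ((ρ v)⁻¹ * π.rot v) + 1 = (blocksAt S v).card) :
    π.IsPlanar := by
  classical
  obtain ⟨a, b, hab⟩ := hS.exists_adj
  rw [π.isPlanar_iff hab]
  refine le_antisymm ?_ (π.le_reflLength_facePerm hS)
  have h1 : π.facePerm = vertexPerm (π.rot⁻¹ * ρ) * ((vertexPerm ρ)⁻¹ * dartFlip S) := by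
    rw [map_mul, map_inv, facePerm, mul_assoc, mul_inv_cancel_left]
  have h2 := reflLength_mul_le (vertexPerm (π.rot⁻¹ * ρ)) ((vertexPerm ρ)⁻¹ * dartFlip S)
  rw [← h1] at h2
  have h3 := reflLength_vertexPerm_le (π.rot⁻¹ * ρ)
  have h4 : ∑ v, reflLength ((π.rot⁻¹ * ρ) v) + S.verts.ncard = ∑ v, (blocksAt S v).card := by
    rw [← sum_ite_mem_eq_ncard, ← Finset.sum_add_distrib]
    refine Finset.sum_congr rfl fun v _ => ?_
    have h5 : reflLength ((π.rot⁻¹ * ρ) v) = reflLength ((ρ v)⁻¹ * π.rot v) := by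
      rw [← reflLength_inv, Pi.mul_apply, Pi.inv_apply, mul_inv_rev, inv_inv]
    rw [h5]
    by_cases hv : v ∈ S.verts
    · rw [if_pos hv, h v hv]
    · have hnone : ∀ w, ¬ S.Adj v w := fun w hw => hv hw.fst_mem
      have h6 : ρ v = 1 := Perm.ext fun w => hρ.fixed v w (hnone w)
      have h7 : π.rot v = 1 := Perm.ext fun w => π.fixed v w (hnone w)
      rw [if_neg hv, h6, h7]
      simp only [inv_one, mul_one, reflLength_one, add_zero]
      symm
      rw [Finset.card_eq_zero, Finset.eq_empty_iff_forall_notMem]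
      exact fun B hB => hv ((mem_blocksAt.1 hB).1.1 (mem_blocksAt.1 hB).2)
  rw [sum_card_blocksAt] at h4
  have h5 := (isDisjointJoin_facePerm hρ hS).reflLength_le
  have h6 : ∑ B ∈ blocksIn S, reflLength (ℰ B).1.facePerm + 2 * (blocksIn S).card =
      ∑ B ∈ blocksIn S, B.1.verts.ncard + ∑ B ∈ blocksIn S, B.1.edgeSet.ncard := by
    rw [mul_comm, ← smul_eq_mul, ← Finset.sum_const, ← Finset.sum_add_distrib,
      ← Finset.sum_add_distrib]
    refine Finset.sum_congr rfl fun B hB => ?_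
    obtain ⟨v, hv⟩ := B.2.prop.1.nonempty
    obtain ⟨w, hw⟩ := hS.block_adj (mem_blocksIn.1 hB) hv
    exact ((ℰ B).1.isPlanar_iff hw).1 (ℰ B).2
  have h7 := sum_ncard_edgeSet_le S
  have h8 := sum_ncard_verts_add_one_le hG (blocksIn S) S (fun B hB => mem_blocksIn.1 hB)
    hab.fst_mem
  omega

/-- Planarity makes the faces of the map split at `v` induce on the edges at `v` a permutation below
`π.rot v` with one cycle per block; the restriction hypothesis identifies it with `ρ v`. -/
theorem local_of_isPlanar (hρ : IsBlockRotation ℰ S ρ) (hS : IsBlockUnion S)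
    (π : RotationSystem S) (hπ : π.IsPlanar)
    (hres : ∀ B : Block G, B.1 ≤ S → π.RestrictsTo (ℰ B).1) {v : V} (hv : v ∈ S.verts) :
    reflLength ((ρ v)⁻¹ * π.rot v) + 1 = (blocksAt S v).card := by
  classical
  obtain ⟨w, hw⟩ := hS.adj_of_mem hv
  rw [π.isPlanar_iff hw] at hπ
  have hsplit := π.le_reflLength_split hS hv
  -- `ω` traces the faces after the splitting, and `q` glues the pieces of `v` together again.
  set ω := (vertexPerm (Function.update π.rot v 1))⁻¹ * dartFlip S with hω
  set q := vertexPerm (Pi.mulSingle v (π.rot v)) with hq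
  have hφ : π.facePerm = q⁻¹ * ω := by
    rw [facePerm, hω, ← mul_assoc, ← mul_inv_rev, hq, ← map_mul]
    congr 3
    ext1 u
    by_cases hu : u = v
    · subst hu
      simp
    · simp [Function.update_of_ne hu, Pi.mulSingle_eq_of_ne hu]
  let A : Set (V × V) := {d | d.1 = v ∧ S.Adj v d.2}
  obtain ⟨ω', hfix, hret, hlen⟩ := exists_firstReturn ω A
  have hωv : ∀ u, S.Adj v u → ω' (v, u) ∈ A := by
    intro u hu
    by_contra hcon
    have := ω'.injective (hfix _ hcon)
    rw [this] at hcon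
    exact hcon ⟨rfl, hu⟩
  have hqfix : ∀ d ∉ A, q⁻¹ d = d := by
    rintro ⟨a, b⟩ hd
    rw [Perm.inv_eq_iff_eq]
    by_cases ha : a = v
    · subst ha
      rw [hq, vertexPerm_mulSingle_apply, π.fixed a b fun h => hd ⟨rfl, h⟩]
    · rw [hq, vertexPerm_mulSingle_apply_of_ne _ ha]
  have hlen' := hlen q⁻¹ hqfix
  rw [← hφ] at hlen'
  -- A split face that arrives at `v` turns back along the same edge, so it never passes through `v`
  -- to another component of the rest.
  have hinv : ∀ u, S.Adj v u → ∀ k : ℕ,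
      (((ω ^ k) (v, u)).1 ≠ v → JoinedAvoiding (⊤ : G.Subgraph) v u ((ω ^ k) (v, u)).1) ∧
      (((ω ^ k) (v, u)).2 ≠ v → JoinedAvoiding (⊤ : G.Subgraph) v u ((ω ^ k) (v, u)).2) := by
    intro u hu k
    induction k with
    | zero => exact ⟨fun h => absurd rfl h, fun _ => .refl (by simp) hu.ne⟩
    | succ k ih =>
      rw [pow_succ', Perm.mul_apply]
      generalize (ω ^ k) (v, u) = d at ih
      obtain ⟨a, b⟩ := d
      obtain ⟨ih1, ih2⟩ := ih
      by_cases hab : S.Adj a b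
      · have hωd : ω (a, b) = (b, (Function.update π.rot v 1 b)⁻¹ a) := by
          rw [hω, Perm.mul_apply, dartFlip_of_adj hab, vertexPerm_inv_apply]
        rw [hωd]
        refine ⟨ih2, fun hne => ?_⟩
        by_cases hb : b = v
        · subst hb
          simp only [Function.update_self, inv_one, Perm.one_apply] at hne ⊢
          exact ih1 hne
        · simp only [Function.update_of_ne hb] at hne ⊢
          have hadj := π.adj_rot_inv.2 hab.symm
          exact (ih2 hb).trans (.of_adj (by simpa using hadj.adj_sub) (Ne.symm hb)
            (Ne.symm hne))
      · have hωd : ω (a, b) = (a, (Function.update π.rot v 1 a)⁻¹ b) := by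
          rw [hω, Perm.mul_apply, dartFlip_of_not_adj hab, vertexPerm_inv_apply]
        have hb : (Function.update π.rot v 1 a)⁻¹ b = b := by
          rw [Perm.inv_eq_iff_eq]
          by_cases ha : a = v
          · subst ha
            simp
          · rw [Function.update_of_ne ha, π.fixed a b hab]
        rw [hωd, hb]
        exact ⟨ih1, ih2⟩
  have hblock : ∀ B ∈ blocksAt S v, ∀ u, B.1.Adj v u → ∃ u', ω' (v, u) = (v, u') ∧
      B.1.Adj v u' := by
    intro B hB u hu
    have hBS := (mem_blocksAt.1 hB).1
    have hSu := hBS.2 hu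
    obtain ⟨k, -, hk, -⟩ := hret (v, u) ⟨rfl, hSu⟩
    have hmem := hωv u hSu
    have h1 := (hinv u hSu k).2
    rw [hk] at h1
    generalize ω' (v, u) = d at hmem h1
    obtain ⟨a, b⟩ := d
    obtain ⟨rfl, hab⟩ := hmem
    refine ⟨b, rfl, ?_⟩
    obtain ⟨B', hB', hB'b⟩ := hS.exists_block a b hab
    have := B.2.eq_of_joinedAvoiding B'.2 hu.fst_mem hB'b.fst_mem hu.snd_mem hB'b.snd_mem
      (h1 hab.ne.symm)
    rwa [this]
  let A' : Block G → Finset (V × V) := fun B => (neighbors B.1 v).map ⟨fun u => (v, u),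
    fun a b h => (Prod.mk.inj h).2⟩
  have hA' : ∀ B d, d ∈ A' B ↔ d.1 = v ∧ B.1.Adj v d.2 := by
    rintro B ⟨a, b⟩
    constructor
    · intro h
      obtain ⟨c, hc, hcb⟩ := Finset.mem_map.1 h
      obtain ⟨rfl, rfl⟩ := Prod.mk.inj hcb
      exact ⟨rfl, mem_neighbors.1 hc⟩
    · rintro ⟨rfl, h⟩
      exact Finset.mem_map.2 ⟨b, mem_neighbors.2 h, rfl⟩
  have hτ : ∀ B : Block G, ∃ τ : Perm (V × V), B ∈ blocksAt S v →
      (∀ d ∈ A' B, τ d = ω' d) ∧ ∀ d ∉ A' B, τ d = d := by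
    intro B
    by_cases hB : B ∈ blocksAt S v
    · obtain ⟨τ, h1, h2⟩ := exists_restrict ω' (A := (A' B : Set (V × V))) <| by
        rintro ⟨a, b⟩ hd
        obtain ⟨rfl, hb⟩ := (hA' B _).1 hd
        obtain ⟨u', hu', hBu'⟩ := hblock B hB b hb
        exact Finset.mem_coe.2 ((hA' B _).2 (hu' ▸ ⟨rfl, hBu'⟩))
      exact ⟨τ, fun _ => ⟨h1, h2⟩⟩
    · exact ⟨1, fun h => absurd h hB⟩
  choose τ hτ using hτ
  have hjoin : IsDisjointJoin (blocksAt S v) τ ω' := by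
    rintro ⟨a, b⟩
    by_cases hd : (a, b) ∈ A
    · obtain ⟨rfl, hab⟩ := hd
      obtain ⟨B, hBS, hBb⟩ := hS.exists_block a b hab
      have hB : B ∈ blocksAt S a := mem_blocksAt.2 ⟨hBS, hBb.fst_mem⟩
      left
      refine ⟨B, hB, ((hτ B hB).1 _ ((hA' B _).2 ⟨rfl, hBb⟩)).symm, fun B' hB' hne => ?_⟩
      have hnot : ∀ y, B.1.Adj a y → (a, y) ∉ A' B' := fun y hy hy' =>
        hne (Subtype.ext (B'.2.eq_of_adj B.2 ((hA' B' _).1 hy').2 hy))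
      obtain ⟨u', hu', hBu'⟩ := hblock B hB b hBb
      rw [hu']
      exact ⟨(hτ B' hB').2 _ (hnot _ hBb), (hτ B' hB').2 _ (hnot _ hBu')⟩
    · right
      refine ⟨hfix _ hd, fun B hB => (hτ B hB).2 _ fun h => hd ?_⟩
      obtain ⟨h1, h2⟩ := (hA' B _).1 h
      exact ⟨h1, (mem_blocksAt.1 hB).1.2 h2⟩
  have hτlen : ∀ B ∈ blocksAt S v, reflLength (τ B) + 1 ≤ (A' B).card := by
    intro B hB
    obtain ⟨u, hu⟩ := hS.block_adj (mem_blocksAt.1 hB).1 (mem_blocksAt.1 hB).2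
    exact reflLength_add_one_le ⟨(v, u), (hA' B _).2 ⟨rfl, hu⟩⟩ (hτ B hB).2
  have hsumA : ∑ B ∈ blocksAt S v, (A' B).card = deg S v := by
    rw [← card_neighbors, (hρ.isCyclePartition hS v).card_eq]
    exact Finset.sum_congr rfl fun B _ => Finset.card_map _
  have hsumle := Finset.sum_le_sum hτlen
  have hsumτ : ∑ B ∈ blocksAt S v, (reflLength (τ B) + 1) =
      ∑ B ∈ blocksAt S v, reflLength (τ B) + (blocksAt S v).card := by
    rw [Finset.sum_add_distrib, ← Finset.card_eq_sum_ones]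
  have hω'le := hjoin.reflLength_le
  have hqlen : reflLength q + 1 = deg S v := by
    rw [hq, reflLength_vertexPerm_mulSingle, π.reflLength_rot_add_one hw]
  have htri := reflLength_mul_le ω' (ω'⁻¹ * q)
  rw [mul_inv_cancel_left] at htri
  have hsymm : reflLength (ω'⁻¹ * q) = reflLength (q⁻¹ * ω') := by
    rw [← reflLength_inv, mul_inv_rev, inv_inv]
  have hcardeq : ∀ B ∈ blocksAt S v, reflLength (τ B) + 1 = (A' B).card :=
    -- The split inequality, planarity and the triangle inequality force `reflLength ω' = deg S v -
    -- b(v)`, the upper bound, so each `τ B` is as long as a full cycle.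
    (Finset.sum_eq_sum_iff_of_le hτlen).1 (by omega)
  have hω'ρ : ω' = vertexPerm (Pi.mulSingle v (ρ v)) := by
    ext1 ⟨a, b⟩
    by_cases hd : (a, b) ∈ A
    · obtain ⟨rfl, hab⟩ := hd
      obtain ⟨B, hBS, hBb⟩ := hS.exists_block a b hab
      have hB : B ∈ blocksAt S a := mem_blocksAt.2 ⟨hBS, hBb.fst_mem⟩
      have hmem : (a, b) ∈ A' B := (hA' B _).2 ⟨rfl, hBb⟩
      have h1 := hjoin.firstReturn_of_geodesic (π := q) (by omega) hB (A := A' B)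
        (hτ B hB).2 (hcardeq B hB).ge (a, b) hmem
      rw [(hτ B hB).1 _ hmem] at h1
      obtain ⟨k, hk, hk1, hk2⟩ := hres B hBS a b hBb
      have hqpow : ∀ j : ℕ, (q ^ j) (a, b) = (a, (π.rot a ^ j) b) := by
        intro j
        rw [hq, vertexPerm_pow_apply, Pi.mulSingle_eq_same]
      -- The first return of `q` to the edges of `B` at this vertex is the rotation of `B` by
      -- restriction, and `ω'` by the geodesic; first returns are unique.
      have h2 : FirstReturn q (A' B : Set (V × V)) (a, b) (a, (ℰ B).1.rot a b) := by
        refine ⟨k, hk, by rw [hqpow, hk1], fun j hj hjk hmem' => hk2 j hj hjk ?_⟩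
        rw [hqpow] at hmem'
        exact ((hA' B _).1 hmem').2
      obtain ⟨u', hu', hBu'⟩ := hblock B hB b hBb
      rw [vertexPerm_mulSingle_apply, hρ.apply_eq B hBS a b hBb]
      refine h1.unique h2 ?_ ?_
      · rw [hu']
        exact (hA' B _).2 ⟨rfl, hBu'⟩
      · exact (hA' B _).2 ⟨rfl, ((ℰ B).1.isCycleOn a).1.mapsTo hBb⟩
    · rw [hfix _ hd]
      by_cases ha : a = v
      · subst ha
        rw [vertexPerm_mulSingle_apply, hρ.fixed a b fun h => hd ⟨rfl, h⟩]
      · rw [vertexPerm_mulSingle_apply_of_ne _ ha]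
  have hfinal : reflLength (ω'⁻¹ * q) = reflLength ((ρ v)⁻¹ * π.rot v) := by
    rw [hω'ρ, hq, ← map_inv, ← map_mul, ← Pi.mulSingle_inv, ← Pi.mulSingle_mul,
      reflLength_vertexPerm_mulSingle]
  have hpos : 0 < (blocksAt S v).card := by
    obtain ⟨B, hBS, hBw⟩ := hS.exists_block v w hw
    exact Finset.card_pos.2 ⟨B, mem_blocksAt.2 ⟨hBS, hBw.fst_mem⟩⟩
  omega

end RotationSystem

end PlanarBlocks

/-! ## Embeddings that extend the embeddings of the blocks -/

namespace PlanarBlocks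

open Equiv Equiv.Perm

variable {V : Type*} {G : SimpleGraph V}

theorem isBlockUnion_top [Finite V] (hG : G.Connected) {a b : V} (hab : G.Adj a b) :
    IsBlockUnion (⊤ : G.Subgraph) where
  connected := by
    rw [SimpleGraph.Subgraph.connected_iff_forall_exists_walk_subgraph]
    refine ⟨⟨a, by simp⟩, fun {u v} _ _ => ?_⟩
    obtain ⟨p⟩ := hG.preconnected u v
    exact ⟨p, le_top⟩
  exists_adj := ⟨a, b, by simpa using hab⟩
  exists_block u v h := by
    obtain ⟨B, hB, hBuv⟩ := exists_isBlock_adj h.adj_sub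
    exact ⟨⟨B, hB⟩, le_top, hBuv⟩

theorem starAt_adj {v a b : V} :
    (starAt G v).Adj a b ↔ ∃ B : Block G, v ∈ B.1.verts ∧ B.1.Adj a b := by
  rw [starAt, SimpleGraph.Subgraph.sSup_adj]
  constructor
  · rintro ⟨B, ⟨hB, hv⟩, h⟩
    exact ⟨⟨B, hB⟩, hv, h⟩
  · rintro ⟨B, hv, h⟩
    exact ⟨B.1, ⟨B.2, hv⟩, h⟩

theorem le_starAt {v : V} {B : Block G} (hv : v ∈ B.1.verts) : B.1 ≤ starAt G v :=
  le_sSup ⟨B.2, hv⟩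

theorem isBlockUnion_starAt [Finite V] {v w : V} (hvw : G.Adj v w) :
    IsBlockUnion (starAt G v) where
  connected := by
    obtain ⟨B, hB, hBvw⟩ := exists_isBlock_adj hvw
    have hub : ∀ u ∈ (starAt G v).verts, ∃ p : G.Walk u v, p.toSubgraph ≤ starAt G v := by
      intro u hu
      rw [starAt, SimpleGraph.Subgraph.verts_sSup, Set.mem_iUnion₂] at hu
      obtain ⟨B', ⟨hB', hv'⟩, hu⟩ := hu
      obtain ⟨p, hp⟩ := (B'.preconnected_iff_forall_exists_walk_subgraph.1
        hB'.prop.1.preconnected) hu hv'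
      exact ⟨p, hp.trans (le_starAt (B := ⟨B', hB'⟩) hv')⟩
    rw [SimpleGraph.Subgraph.connected_iff_forall_exists_walk_subgraph]
    refine ⟨⟨v, (le_starAt (B := ⟨B, hB⟩) hBvw.fst_mem).1 hBvw.fst_mem⟩, fun {a b} ha hb => ?_⟩
    obtain ⟨p, hp⟩ := hub a ha
    obtain ⟨q, hq⟩ := hub b hb
    refine ⟨p.append q.reverse, ?_⟩
    rw [SimpleGraph.Walk.toSubgraph_append, SimpleGraph.Walk.toSubgraph_reverse]
    exact sup_le hp hq
  exists_adj := by
    obtain ⟨B, hB, hBvw⟩ := exists_isBlock_adj hvw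
    exact ⟨v, w, starAt_adj.2 ⟨⟨B, hB⟩, hBvw.fst_mem, hBvw⟩⟩
  exists_block a b h := by
    obtain ⟨B, hv, hB⟩ := starAt_adj.1 h
    exact ⟨B, le_starAt hv, hB⟩

theorem le_starAt_iff [Finite V] {v w : V} (hvw : G.Adj v w) {B : Block G} :
    B.1 ≤ starAt G v ↔ v ∈ B.1.verts := by
  refine ⟨fun h => ?_, le_starAt⟩
  obtain ⟨a, ha⟩ := B.2.prop.1.nonempty
  obtain ⟨b, hab⟩ := (isBlockUnion_starAt hvw).block_adj h ha
  obtain ⟨B', hv, hB'⟩ := starAt_adj.1 (h.2 hab)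
  rwa [B.2.eq_of_adj B'.2 hab hB']

/-! ### Embeddings as families of local rotations. -/

section Extension

variable [Fintype V] [DecidableEq V] {ℰ : ∀ B : Block G, SphereEmbedding B.1}
  {S : G.Subgraph} {ρ : V → Perm V}

theorem RotationSystem.rot_mem_cyclesAbove (hρ : IsBlockRotation ℰ S ρ) (hS : IsBlockUnion S)
    (π : RotationSystem S) (hπ : π.IsPlanar)
    (hres : ∀ B : Block G, B.1 ≤ S → π.RestrictsTo (ℰ B).1) {v : V} (hv : v ∈ S.verts) :
    π.rot v ∈ cyclesAbove (ρ v) (blocksAt S v).card (neighbors S v) := by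
  refine mem_cyclesAbove.2 ⟨?_, fun w hw => π.fixed v w fun h => hw (mem_neighbors.2 h),
    π.local_of_isPlanar hρ hS hπ hres hv⟩
  rw [coe_neighbors]
  exact π.isCycleOn v

theorem exists_rotationSystem (hG : G.Connected) (hρ : IsBlockRotation ℰ S ρ)
    (hS : IsBlockUnion S) {σ : V → Perm V}
    (hσ : ∀ v ∈ S.verts, σ v ∈ cyclesAbove (ρ v) (blocksAt S v).card (neighbors S v))
    (hσ' : ∀ v ∉ S.verts, σ v = 1) :
    ∃ π : RotationSystem S, π.rot = σ ∧ π.IsPlanar ∧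
      ∀ B : Block G, B.1 ≤ S → π.RestrictsTo (ℰ B).1 := by
  let π : RotationSystem S :=
    { rot := σ
      isCycleOn := fun v => by
        by_cases hv : v ∈ S.verts
        · rw [← coe_neighbors]
          exact (mem_cyclesAbove.1 (hσ v hv)).1
        · rw [hσ' v hv, isCycleOn_one]
          exact fun w hw => absurd (SimpleGraph.Subgraph.Adj.fst_mem hw) hv
      fixed := fun v w hw => by
        by_cases hv : v ∈ S.verts
        · exact (mem_cyclesAbove.1 (hσ v hv)).2.1 w fun h => hw (mem_neighbors.1 h)
        · rw [hσ' v hv, Perm.one_apply] }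
  have hloc : ∀ v ∈ S.verts, reflLength ((ρ v)⁻¹ * π.rot v) + 1 = (blocksAt S v).card :=
    fun v hv => (mem_cyclesAbove.1 (hσ v hv)).2.2
  exact ⟨π, rfl, π.isPlanar_of_local hG hρ hS hloc,
    fun B hB => π.restrictsTo_of_local hρ hS hloc hB⟩

/-- With one block the length condition says that `(ρ v)⁻¹ * σ` has length zero. -/
theorem mem_cyclesAbove_iff_eq (hρ : IsBlockRotation ℰ S ρ) (hS : IsBlockUnion S) {v : V}
    (h1 : (blocksAt S v).card = 1) {σ : Perm V} :
    σ ∈ cyclesAbove (ρ v) (blocksAt S v).card (neighbors S v) ↔ σ = ρ v := by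
  have hpart := hρ.isCyclePartition hS v
  obtain ⟨B, hB⟩ := Finset.card_eq_one.1 h1
  have hs : neighbors S v = neighbors B.1 v := by
    rw [hpart.eq_biUnion, hB, Finset.singleton_biUnion]
  rw [mem_cyclesAbove, h1]
  constructor
  · rintro ⟨-, -, h⟩
    have := eq_one_of_reflLength_eq_zero (σ := (ρ v)⁻¹ * σ) (by omega)
    exact (inv_mul_eq_one.1 this).symm
  · rintro rfl
    refine ⟨?_, hpart.fixed, by simp⟩
    rw [hs]
    exact hpart.isCycleOn B (by rw [hB]; exact Finset.mem_singleton_self B)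

omit [DecidableEq V] in
theorem neighbors_starAt (v : V) : neighbors (starAt G v) v = neighbors (⊤ : G.Subgraph) v := by
  ext w
  rw [mem_neighbors, mem_neighbors, starAt_adj]
  constructor
  · rintro ⟨B, -, h⟩
    exact h.adj_sub
  · intro h
    obtain ⟨B, hB, hBvw⟩ := exists_isBlock_adj (G := G) h
    exact ⟨⟨B, hB⟩, hBvw.fst_mem, hBvw⟩

omit [DecidableEq V] in
theorem blocksAt_starAt (v : V) : blocksAt (starAt G v) v = blocksAt (⊤ : G.Subgraph) v := by
  ext B
  rw [mem_blocksAt, mem_blocksAt]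
  exact ⟨fun h => ⟨le_top, h.2⟩, fun h => ⟨le_starAt h.2, h.2⟩⟩

-- Every block in `starAt G v` contains `v`, and distinct blocks share at most one vertex.
omit [DecidableEq V] in
theorem card_blocksAt_starAt_of_ne {v u w : V} (hvu : G.Adj v u)
    (hw : w ∈ (starAt G v).verts) (hwv : w ≠ v) : (blocksAt (starAt G v) w).card = 1 := by
  obtain ⟨x, hx⟩ := (isBlockUnion_starAt hvu).adj_of_mem hw
  obtain ⟨B, hB, hBw⟩ := starAt_adj.1 hx
  refine Finset.card_eq_one.2 ⟨B, Finset.eq_singleton_iff_unique_mem.2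
    ⟨mem_blocksAt.2 ⟨le_starAt hB, hBw.fst_mem⟩, fun B' hB' => ?_⟩⟩
  obtain ⟨h1, h2⟩ := mem_blocksAt.1 hB'
  exact Subtype.ext (B'.2.eq_of_mem B.2 hwv h2 ((le_starAt_iff hvu).1 h1) hBw.fst_mem hB)

omit [DecidableEq V] in
theorem card_blocksAt_of_not_isCutVertex (hS : IsBlockUnion (⊤ : G.Subgraph)) {v : V}
    (hv : ¬ IsCutVertex (⊤ : G.Subgraph) v) : (blocksAt (⊤ : G.Subgraph) v).card = 1 := by
  obtain ⟨x, hx⟩ := hS.adj_of_mem (v := v) (by simp)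
  obtain ⟨B, hB, hBv⟩ := hS.exists_block v x hx
  refine Finset.card_eq_one.2 ⟨B, Finset.eq_singleton_iff_unique_mem.2
    ⟨mem_blocksAt.2 ⟨hB, hBv.fst_mem⟩, fun B' hB' => ?_⟩⟩
  exact Subtype.ext (eq_of_not_isCutVertex hv hx.adj_sub B'.2 B.2 (mem_blocksAt.1 hB').2
    hBv.fst_mem)

/-- The possible rotations around `v` of an embedding that extends the embeddings of the
blocks. -/
abbrev LocalRotation (ρ : V → Perm V) (v : V) : Type _ :=
  {σ : Perm V // σ ∈ cyclesAbove (ρ v) (blocksAt (⊤ : G.Subgraph) v).card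
    (neighbors (⊤ : G.Subgraph) v)}

theorem exists_embeddingsExtending_equiv (hG : G.Connected) (hS : IsBlockUnion (⊤ : G.Subgraph))
    (hρ : IsBlockRotation ℰ ⊤ ρ) :
    ∃ e : EmbeddingsExtending ℰ ≃ ∀ v : CutVertex G, LocalRotation (G := G) ρ v.1,
      ∀ 𝓔 v, (e 𝓔 v).1 = 𝓔.1.1.rot v.1 := by
  classical
  have hmem : ∀ (𝓔 : EmbeddingsExtending ℰ) v, 𝓔.1.1.rot v ∈ cyclesAbove (ρ v)
      (blocksAt (⊤ : G.Subgraph) v).card (neighbors (⊤ : G.Subgraph) v) := fun 𝓔 v =>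
    𝓔.1.1.rot_mem_cyclesAbove hρ hS 𝓔.1.2 (fun B _ => 𝓔.2 B) (by simp)
  refine ⟨Equiv.ofBijective (fun 𝓔 v => ⟨𝓔.1.1.rot v.1, hmem 𝓔 v.1⟩) ⟨?_, ?_⟩,
    fun 𝓔 v => rfl⟩
  · intro 𝓔 𝓔' h
    refine Subtype.ext (Subtype.ext (RotationSystem.ext (funext fun v => ?_)))
    by_cases hv : IsCutVertex (⊤ : G.Subgraph) v
    · exact congrArg Subtype.val (congrFun h ⟨v, hv⟩)
    · have h1 := card_blocksAt_of_not_isCutVertex hS hv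
      rw [(mem_cyclesAbove_iff_eq hρ hS h1).1 (hmem 𝓔 v),
        (mem_cyclesAbove_iff_eq hρ hS h1).1 (hmem 𝓔' v)]
  · intro f
    obtain ⟨π, h1, h2, h3⟩ := exists_rotationSystem (σ := fun v =>
      if hv : IsCutVertex (⊤ : G.Subgraph) v then (f ⟨v, hv⟩).1 else ρ v) hG hρ hS
      (fun v _ => by
        by_cases hv : IsCutVertex (⊤ : G.Subgraph) v
        · rw [dif_pos hv]
          exact (f ⟨v, hv⟩).2
        · rw [dif_neg hv]
          exact (mem_cyclesAbove_iff_eq hρ hS (card_blocksAt_of_not_isCutVertex hS hv)).2 rfl)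
      (fun v hv => absurd (by simp) hv)
    refine ⟨⟨⟨π, h2⟩, fun B => h3 B le_top⟩, funext fun v => Subtype.ext ?_⟩
    change π.rot v.1 = _
    rw [h1]
    exact dif_pos v.2

/-- The rotation at `v` is the only freedom, as every other vertex of `starAt G v` lies in just one
of its blocks. The last clause records the forced rotations for `restrictsTo_arrangement`. -/
theorem exists_arrangement_equiv (hG : G.Connected) (hρ : IsBlockRotation ℰ ⊤ ρ) {v u : V}
    (hvu : G.Adj v u) :
    ∃ e : Arrangement ℰ v ≃ LocalRotation (G := G) ρ v,
      (∀ a, (e a).1 = a.1.1.rot v) ∧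
      ∀ a : Arrangement ℰ v, ∀ w, w ≠ v → ∀ B : Block G, v ∈ B.1.verts → ∀ x, B.1.Adj w x →
        a.1.1.rot w x = (ℰ B).1.rot w x := by
  classical
  have hS := isBlockUnion_starAt hvu
  obtain ⟨ρ', hρ'⟩ := exists_isBlockRotation ℰ (starAt G v)
  have hρv : ρ' v = ρ v := by
    ext x
    by_cases hx : (starAt G v).Adj v x
    · obtain ⟨B, hB, hBx⟩ := hS.exists_block v x hx
      rw [hρ'.apply_eq B hB v x hBx, hρ.apply_eq B le_top v x hBx]
    · rw [hρ'.fixed v x hx, hρ.fixed v x]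
      rwa [← mem_neighbors, neighbors_starAt, mem_neighbors] at hx
  have hvS : v ∈ (starAt G v).verts := by
    have : u ∈ neighbors (starAt G v) v := by
      rw [neighbors_starAt]
      simpa using hvu
    exact (mem_neighbors.1 this).fst_mem
  have hmem : ∀ (a : Arrangement ℰ v), ∀ w ∈ (starAt G v).verts, a.1.1.rot w ∈
      cyclesAbove (ρ' w) (blocksAt (starAt G v) w).card (neighbors (starAt G v) w) :=
    fun a w hw => a.1.1.rot_mem_cyclesAbove hρ' hS a.1.2
      (fun B hB => a.2 ⟨B, (le_starAt_iff hvu).1 hB⟩) hw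
  have hne : ∀ (a : Arrangement ℰ v) w, w ≠ v → a.1.1.rot w = ρ' w := by
    intro a w hwv
    by_cases hw : w ∈ (starAt G v).verts
    · exact (mem_cyclesAbove_iff_eq hρ' hS (card_blocksAt_starAt_of_ne hvu hw hwv)).1 (hmem a w hw)
    · ext x
      have hx : ¬ (starAt G v).Adj w x := fun h => hw h.fst_mem
      rw [a.1.1.fixed w x hx, hρ'.fixed w x hx]
  have hmemv : ∀ a : Arrangement ℰ v, a.1.1.rot v ∈ cyclesAbove (ρ v)
      (blocksAt (⊤ : G.Subgraph) v).card (neighbors (⊤ : G.Subgraph) v) := by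
    intro a
    rw [← hρv, ← blocksAt_starAt, ← neighbors_starAt]
    exact hmem a v hvS
  refine ⟨Equiv.ofBijective (fun a => ⟨a.1.1.rot v, hmemv a⟩) ⟨?_, ?_⟩, fun a => rfl,
    fun a w hwv B hB x hx => ?_⟩
  · intro a a' h
    refine Subtype.ext (Subtype.ext (RotationSystem.ext (funext fun w => ?_)))
    by_cases hwv : w = v
    · subst hwv
      exact congrArg Subtype.val h
    · rw [hne a w hwv, hne a' w hwv]
  · rintro ⟨σ, hσ⟩
    obtain ⟨π, h1, h2, h3⟩ := exists_rotationSystem (σ := Function.update ρ' v σ) hG hρ' hS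
      (fun w hw => by
        by_cases hwv : w = v
        · subst hwv
          rw [Function.update_self, hρv, blocksAt_starAt, neighbors_starAt]
          exact hσ
        · rw [Function.update_of_ne hwv]
          exact (mem_cyclesAbove_iff_eq hρ' hS (card_blocksAt_starAt_of_ne hvu hw hwv)).2 rfl)
      (fun w hw => by
        have hwv : w ≠ v := fun h => hw (h ▸ hvS)
        rw [Function.update_of_ne hwv]
        ext x
        exact hρ'.fixed w x fun h => hw h.fst_mem)
    refine ⟨⟨⟨π, h2⟩, fun B => h3 B.1 (le_starAt B.2)⟩, Subtype.ext ?_⟩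
    change π.rot v = _
    rw [h1, Function.update_self]
  · rw [hne a w hwv, hρ'.apply_eq B (le_starAt hB) w x hx]

-- At `w ≠ v` the neighbours in `starAt G v` all belong to one block, so a first return to that
-- block is a first return to `starAt G v`.
omit [Fintype V] [DecidableEq V] in
theorem restrictsTo_arrangement {v : V}
    (𝓔 : EmbeddingsExtending ℰ) (a : Arrangement ℰ v) (hv : a.1.1.rot v = 𝓔.1.1.rot v)
    (ha : ∀ w, w ≠ v → ∀ B : Block G, v ∈ B.1.verts → ∀ x, B.1.Adj w x →
      a.1.1.rot w x = (ℰ B).1.rot w x) : 𝓔.1.1.RestrictsTo a.1.1 := by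
  intro w x hx
  by_cases hwv : w = v
  · subst hwv
    exact ⟨1, one_pos, by rw [pow_one, hv], fun j h0 h1 => by omega⟩
  · obtain ⟨B, hB, hBx⟩ := starAt_adj.1 hx
    obtain ⟨k, hk, h1, h2⟩ := 𝓔.2 B w x hBx
    refine ⟨k, hk, by rw [h1, ha w hwv B hB x hBx], fun j h0 hj hmem => h2 j h0 hj ?_⟩
    obtain ⟨B', hB', hB'y⟩ := starAt_adj.1 hmem
    have := B.2.eq_of_mem B'.2 hwv hBx.fst_mem hB hB'y.fst_mem hB'
    rw [this]
    exact hB'y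

end Extension

/-! ### The number of local rotations and of tuples. -/

section Cardinality

open scoped Nat

theorem prod_Icc_sub_mul_factorial (n k : ℕ) (h : k ≤ n) :
    (∏ j ∈ Finset.Icc 1 k, (n + 1 - j)) * (n - k)! = n ! := by
  induction k with
  | zero => simp
  | succ k ih =>
    rw [Finset.prod_Icc_succ_top (by omega), mul_assoc, ← ih (by omega)]
    congr 1
    have h1 : n - k = n - (k + 1) + 1 := by omega
    rw [h1, Nat.factorial_succ]
    congr 1
    omega

theorem card_blocksAt_top [Finite V] (v : V) :
    (blocksAt (⊤ : G.Subgraph) v).card = numBlocksAt G v := by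
  exact (Nat.subtype_card _ fun B => by simp).symm

theorem card_localRotation [Fintype V] [DecidableEq V] {ℰ : ∀ B : Block G, SphereEmbedding B.1}
    {ρ : V → Perm V} (hS : IsBlockUnion (⊤ : G.Subgraph)) (hρ : IsBlockRotation ℰ ⊤ ρ) {v : V}
    (hv : 2 ≤ numBlocksAt G v) :
    Nat.card (LocalRotation (G := G) ρ v) = numArrangements G v := by
  classical
  have hpart := hρ.isCyclePartition hS v
  have hlen := hpart.reflLength_add_card
  have hb := card_blocksAt_top (G := G) v
  have hdeg := card_neighbors (⊤ : G.Subgraph) v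
  obtain ⟨n, hn⟩ : ∃ n, deg (⊤ : G.Subgraph) v = n + 1 := ⟨deg (⊤ : G.Subgraph) v - 1, by omega⟩
  obtain ⟨k, hk⟩ : ∃ k, numBlocksAt G v = k + 2 := ⟨numBlocksAt G v - 2, by omega⟩
  -- Here `δ_v = n + 1` and `b(v) = k + 2`, so `m = δ_v - b(v)`; `hlen` shows that the subtraction
  -- is not truncated.
  have h1 := hpart.card_cyclesAbove (n := n) (m := n - k - 1) (by omega) (by omega)
  have h2 := prod_Icc_sub_mul_factorial n k (by omega)
  have h3 : n - k - 1 + 1 = n - k := by omega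
  have h4 : ∏ B ∈ blocksAt (⊤ : G.Subgraph) v, (neighbors B.1 v).card =
      ∏ᶠ B : BlockAt G v, deg B.1.1 v := by
    have := Fintype.ofFinite (BlockAt G v)
    rw [finprod_eq_prod_of_fintype, ← Finset.prod_subtype (p := fun B : Block G => v ∈ B.1.verts)
      (blocksAt (⊤ : G.Subgraph) v) (fun B => by simp) (fun B => deg B.1 v)]
    exact Finset.prod_congr rfl fun B _ => card_neighbors _ _
  rw [Nat.card_eq_fintype_card, Fintype.card_coe]
  rw [h3, h4, ← h2, ← mul_assoc] at h1
  rw [Nat.eq_of_mul_eq_mul_right (Nat.factorial_pos _) h1, numArrangements, hk, hn]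
  rfl

theorem card_entries [Finite V] (v : V) :
    Nat.card (CEntries G v × DEntries G v) = numArrangements G v := by
  classical
  have := Fintype.ofFinite (BlockAt G v)
  rw [Nat.card_prod, Nat.card_pi, Nat.card_pi, numArrangements, finprod_eq_prod_of_fintype]
  simp only [Nat.card_eq_fintype_card, Fintype.card_fin]
  congr 1
  rw [Fin.prod_univ_eq_prod_range (fun k => deg (⊤ : G.Subgraph) v - (k + 1)),
    Finset.range_eq_Ico, Finset.prod_Ico_add' (fun k => deg (⊤ : G.Subgraph) v - k)]
  rfl

end Cardinality

theorem CutVertex.exists_adj (hG : G.Connected) (v : CutVertex G) : ∃ u, G.Adj v.1 u := by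
  obtain ⟨v, -, hv⟩ := v
  rw [deleteVerts_preconnected_iff] at hv
  push Not at hv
  obtain ⟨a, -, b, -, hav, -⟩ := hv
  have : Nontrivial V := ⟨⟨a, v, hav⟩⟩
  exact hG.preconnected.exists_adj_of_nontrivial v

/-- The graph is a single vertex. Its trivial rotation system is planar because of the one face that
`numFaces` grants to an edgeless graph. -/
theorem nonempty_unique_embeddingsExtending [Finite V] (hG : G.Connected)
    (h : ∀ a b, ¬ G.Adj a b) (ℰ : ∀ B : Block G, SphereEmbedding B.1) :
    Nonempty (Unique (EmbeddingsExtending ℰ)) := by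
  have hnone : ∀ (S : G.Subgraph) v w, w ∉ S.neighborSet v := fun S v w hw =>
    h v w (SimpleGraph.Subgraph.Adj.adj_sub hw)
  have hsub : Subsingleton V := by
    by_contra hcon
    rw [not_subsingleton_iff_nontrivial] at hcon
    obtain ⟨v⟩ := hG.nonempty
    obtain ⟨u, hu⟩ := hG.preconnected.exists_adj_of_nontrivial v
    exact h v u hu
  obtain ⟨v₀⟩ := hG.nonempty
  let π : RotationSystem (⊤ : G.Subgraph) :=
    { rot := 1
      isCycleOn := fun v => isCycleOn_of_subsingleton _ _
      fixed := fun v w _ => rfl }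
  have hπ : π.IsPlanar := by
    have h1 : (⊤ : G.Subgraph).verts.ncard = 1 := by
      rw [SimpleGraph.Subgraph.verts_top, Set.ncard_eq_one]
      exact ⟨v₀, Set.eq_singleton_iff_unique_mem.2 ⟨Set.mem_univ _,
        fun x _ => Subsingleton.elim x v₀⟩⟩
    have h2 : π.faceBoundaries = ∅ := by
      refine Set.eq_empty_of_forall_notMem ?_
      rintro O ⟨d, hd, -⟩
      exact h _ _ hd.adj_sub
    have h3 : (⊤ : G.Subgraph).edgeSet = ∅ := by
      refine Set.eq_empty_of_forall_notMem fun e he => ?_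
      induction e with
      | h a b => exact h a b (SimpleGraph.Subgraph.mem_edgeSet.1 he).adj_sub
    rw [RotationSystem.IsPlanar, RotationSystem.numFaces, h1, h2, h3]
    simp
  refine ⟨⟨⟨⟨⟨π, hπ⟩, fun B v u hu => absurd hu (hnone _ v u)⟩⟩, fun 𝓔 => ?_⟩⟩
  exact Subtype.ext (Subtype.ext (RotationSystem.ext (Subsingleton.elim _ _)))

/-- A family of tuples of entries, one for each cut-vertex, as a sequence. -/
def sequenceEquiv (G : SimpleGraph V) :
    (∀ v : CutVertex G, CEntries G v.1 × DEntries G v.1) ≃ Sequence G where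
  toFun f := (fun v => (f v).1, fun v => (f v).2)
  invFun q v := (q.1 v, q.2 v)
  left_inv _ := rfl
  right_inv _ := rfl

/-- Both sides are identified with families of local rotations, which match an embedding with its
restrictions. Without edges there are no cut-vertices, and both sides have one element. -/
theorem exists_equiv_restrict [Finite V] (hG : G.Connected)
    (ℰ : ∀ B : Block G, SphereEmbedding B.1) :
    (∃ e : EmbeddingsExtending ℰ ≃ ∀ v : CutVertex G, Arrangement ℰ v.1,
      ∀ (𝓔 : EmbeddingsExtending ℰ) (v : CutVertex G), 𝓔.1.1.RestrictsTo (e 𝓔 v).1.1) ∧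
    ∀ v : CutVertex G, Nat.card (Arrangement ℰ v.1) = numArrangements G v.1 := by
  classical
  have := Fintype.ofFinite V
  by_cases h : ∃ a b, G.Adj a b
  · obtain ⟨a, b, hab⟩ := h
    have hS := isBlockUnion_top hG hab
    obtain ⟨ρ, hρ⟩ := exists_isBlockRotation ℰ (⊤ : G.Subgraph)
    obtain ⟨e, he⟩ := exists_embeddingsExtending_equiv hG hS hρ
    choose u hu using CutVertex.exists_adj hG
    choose eA heA hne using fun v : CutVertex G => exists_arrangement_equiv hG hρ (hu v)
    refine ⟨⟨e.trans (Equiv.piCongrRight fun v => (eA v).symm), fun 𝓔 v => ?_⟩, fun v => ?_⟩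
    · refine restrictsTo_arrangement 𝓔 _ ?_ (hne v _)
      rw [← heA v, ← he]
      exact congrArg Subtype.val ((eA v).apply_symm_apply _)
    · rw [Nat.card_congr (eA v), card_localRotation hS hρ (two_le_numBlocksAt hG v.2)]
  · push Not at h
    have hcut : IsEmpty (CutVertex G) :=
      ⟨fun v => (CutVertex.exists_adj hG v).elim fun u hu => h _ _ hu⟩
    obtain ⟨_⟩ := nonempty_unique_embeddingsExtending hG h ℰ
    exact ⟨⟨Equiv.ofUnique _ _, fun 𝓔 v => hcut.elim v⟩, fun v => hcut.elim v⟩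

end PlanarBlocks

open PlanarBlocks in
/-- The embeddings of `G` on the sphere that extend the given embeddings of its blocks are in
bijection with the sequences of entries `c`, `d`. For each cut-vertex `v`, the arrangements around
`v` can be numbered by `0, …, E_v - 1`, and for every choice of such numberings `φ v`, and of
numberings `ψ v` of the tuples of `v`, there is a bijection `Φ` that is obtained from them cut-vertex
by cut-vertex: the tuple of `v` in `Φ 𝓔` has the number of the arrangement that `𝓔` induces
around `v`. -/
theorem mainTheorem5 {V : Type*} [Finite V] (G : SimpleGraph V) (hG : G.Connected)
    (ℰ : ∀ B : Block G, SphereEmbedding B.1) :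
    Nonempty (EmbeddingsExtending ℰ ≃ Sequence G) ∧
    (∀ v : CutVertex G, Nonempty (Arrangement ℰ v.1 ≃ Fin (numArrangements G v.1))) ∧
    (∀ v : CutVertex G,
      Nonempty ((CEntries G v.1 × DEntries G v.1) ≃ Fin (numArrangements G v.1))) ∧
    ∀ (φ : ∀ v : CutVertex G, Arrangement ℰ v.1 ≃ Fin (numArrangements G v.1))
      (ψ : ∀ v : CutVertex G,
        (CEntries G v.1 × DEntries G v.1) ≃ Fin (numArrangements G v.1)),
      ∃ Φ : EmbeddingsExtending ℰ ≃ Sequence G,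
        ∀ (𝓔 : EmbeddingsExtending ℰ) (v : CutVertex G),
          ∃ a : Arrangement ℰ v.1, 𝓔.1.1.RestrictsTo a.1.1 ∧
            φ v a = ψ v ((Φ 𝓔).1 v, (Φ 𝓔).2 v) := by
  obtain ⟨⟨e, he⟩, hcard⟩ := exists_equiv_restrict hG ℰ
  have hA : ∀ v : CutVertex G, Nonempty (Arrangement ℰ v.1 ≃ Fin (numArrangements G v.1)) :=
    fun v => by
      have := Fintype.ofFinite V
      have : Finite (RotationSystem (starAt G v.1)) :=
        Finite.of_injective RotationSystem.rot fun π π' h => RotationSystem.ext h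
      exact ⟨Finite.equivFinOfCardEq (hcard v)⟩
  have hT : ∀ v : CutVertex G,
      Nonempty ((CEntries G v.1 × DEntries G v.1) ≃ Fin (numArrangements G v.1)) :=
    fun v => ⟨Finite.equivFinOfCardEq (card_entries v.1)⟩
  have hΦ : ∀ (φ : ∀ v : CutVertex G, Arrangement ℰ v.1 ≃ Fin (numArrangements G v.1))
      (ψ : ∀ v : CutVertex G,
        (CEntries G v.1 × DEntries G v.1) ≃ Fin (numArrangements G v.1)),
      ∃ Φ : EmbeddingsExtending ℰ ≃ Sequence G,
        ∀ (𝓔 : EmbeddingsExtending ℰ) (v : CutVertex G),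
          ∃ a : Arrangement ℰ v.1, 𝓔.1.1.RestrictsTo a.1.1 ∧
            φ v a = ψ v ((Φ 𝓔).1 v, (Φ 𝓔).2 v) := by
    intro φ ψ
    -- At each cut-vertex, number the induced arrangement by `φ v` and decode the number by the
    -- inverse of `ψ v`.
    refine ⟨(e.trans (Equiv.piCongrRight fun v => (φ v).trans (ψ v).symm)).trans
      (sequenceEquiv G), fun 𝓔 v => ⟨e 𝓔 v, he 𝓔 v, ?_⟩⟩
    exact ((ψ v).apply_symm_apply _).symm
  obtain ⟨Φ, -⟩ := hΦ (fun v => (hA v).some) (fun v => (hT v).some)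
  exact ⟨⟨Φ⟩, hA, hT, hΦ⟩
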